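/- Let $V:(0,\infty)\to\mathbb C$ be a measurable potential such that $\int_0^\infty e^{ax}|V(x)|\,dx<\infty$ for a certain $a>0$. Let $L_V=-d^2/dx^2+V(x)$ be the Schrödinger operator in $L^2(0,\infty)$ with Dirichlet boundary condition at zero; its domain consists of all $y\in L^2(0,\infty)$ with $y,y'$ locally absolutely continuous on $[0,\infty)$, $y(0)=0$ and $-y''+Vy\in L^2(0,\infty)$. For $k$ with $\operatorname{Im}k\ge 0$ let $e(x,k)$ be the Jost solution, i.e. the solution of $-y''+V(x)y=k^2y$ on $[0,\infty)$ with $e(x,k)\sim e^{ikx}$ as $x\to\infty$, and let $e(k)=e(0,k)$ be the Jost function. The spectral singularities of $L_V$ are the points $\lambda=k^2$ with $k\in\mathbb R$, $e(k)=0$; the multiplicity of such a point is the order of the zero $k$ of (the analytic continuation of) $e(\cdot)$. Let $N(V)$ be the total multiplicity of the eigenvalues of $L_V$ (each counted with its algebraic multiplicity, the dimension of its root subspace) and of the spectral singularities. Let $R\ge 0$ be the minimal radius of discs centred at the origin that contain all zeros of $e(k)$ in the closed upper half-plane, and for $\alpha\in[0,1)$ put $$\widetilde R(\alpha)=\Big(\frac1{\ln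 2}\int_0^\infty(2x)^\alpha|V(x)|\,dx\Big)^{1/(1-\alpha)} .$$ Then for all $\alpha,\beta\in[0,1)$ and all $A>\max\{\widetilde R(\alpha),\,R^2/a-a/4\}$, $$N(V)\ \le\ \Big(\ln\frac{A+a/2}{\sqrt{A^2+R^2}}\Big)^{-1}\bigg\{\frac1{a^{1-\beta}}\int_0^\infty x^\beta(1+e^{ax})|V(x)|\,dx-\ln\Big(2-2^{(\widetilde R(\alpha)/A)^{1-\alpha}}\Big)\bigg\},$$ where the right-hand side is understood as $+\infty$ if the integral diverges (which is possible only for $\beta>0$). -/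

import Mathlib

open MeasureTheory Set Filter Topology
open scoped ENNReal

noncomputable section

namespace HalfLineSchrodinger

/-- `y` solves `-y'' + V y = f` on `[0, ∞)`: `y` is differentiable on `[0, ∞)` with a locally
absolutely continuous derivative `p`, and `p' = V y - f` almost everywhere. Absolute continuity
of `p` is expressed by `p` being the integral of the locally integrable function `V y - f`. -/
def Solves (V f y : ℝ → ℂ) : Prop :=
  ∃ p : ℝ → ℂ,
    (∀ x, 0 ≤ x → HasDerivWithinAt y (p x) (Ici 0) x) ∧
    (∀ x, 0 ≤ x → IntervalIntegrable (fun t => V t * y t - f t) volume 0 x) ∧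
    ∀ x, 0 ≤ x → p x = p 0 + ∫ t in (0 : ℝ)..x, (V t * y t - f t)

/-- The Hilbert space `L²(0, ∞)`. -/
abbrev H : Type := Lp ℂ 2 (volume.restrict (Ioi (0 : ℝ)))

theorem Solves.congr {V f g y : ℝ → ℂ} (h : Solves V f y)
    (hfg : f =ᵐ[volume.restrict (Ioi (0 : ℝ))] g) : Solves V g y := by
  obtain ⟨p, h1, h2, h3⟩ := h
  have key : ∀ x, 0 ≤ x → (fun t => V t * y t - f t) =ᵐ[volume.restrict (uIoc 0 x)]
      (fun t => V t * y t - g t) := by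
    intro x hx
    have : f =ᵐ[volume.restrict (uIoc 0 x)] g :=
      ae_restrict_of_ae_restrict_of_subset
        (by rw [uIoc_of_le hx]; exact fun t ht => ht.1) hfg
    filter_upwards [this] with t ht
    rw [ht]
  refine ⟨p, h1, fun x hx => (h2 x hx).congr_ae (key x hx), fun x hx => ?_⟩
  rw [h3 x hx, intervalIntegral.integral_congr_ae_restrict (key x hx)]

theorem Solves.add {V f g y z : ℝ → ℂ} (h : Solves V f y) (h' : Solves V g z) :
    Solves V (f + g) (y + z) := by
  obtain ⟨p, h1, h2, h3⟩ := h
  obtain ⟨q, k1, k2, k3⟩ := h'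
  have e : (fun t => V t * (y + z) t - (f + g) t) =
      fun t => (V t * y t - f t) + (V t * z t - g t) := by
    funext t; simp only [Pi.add_apply]; ring
  refine ⟨p + q, fun x hx => (h1 x hx).add (k1 x hx), fun x hx => ?_, fun x hx => ?_⟩
  · rw [e]; exact (h2 x hx).add (k2 x hx)
  · rw [e, intervalIntegral.integral_add (h2 x hx) (k2 x hx)]
    simp only [Pi.add_apply]
    rw [h3 x hx, k3 x hx]; ring

theorem Solves.smul {V f y : ℝ → ℂ} (c : ℂ) (h : Solves V f y) :
    Solves V (c • f) (c • y) := by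
  obtain ⟨p, h1, h2, h3⟩ := h
  have e : (fun t => V t * (c • y) t - (c • f) t) = fun t => c * (V t * y t - f t) := by
    funext t; simp only [Pi.smul_apply, smul_eq_mul]; ring
  refine ⟨c • p, fun x hx => (h1 x hx).const_smul c, fun x hx => ?_, fun x hx => ?_⟩
  · rw [e]; exact (h2 x hx).const_mul c
  · rw [e, intervalIntegral.integral_const_mul]
    simp only [Pi.smul_apply, smul_eq_mul]
    rw [h3 x hx]; ring

/-- The graph of `L_V = -d²/dx² + V` with the Dirichlet condition at zero, on its maximal domain:
all pairs `(u, f)` in `L²(0, ∞)` such that `u` has a representative `y` with a locally absolutely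
continuous derivative, `y(0) = 0` and `-y'' + V y = f`. -/
def graph (V : ℝ → ℂ) : Submodule ℂ (H × H) where
  carrier := {w | ∃ y : ℝ → ℂ,
    w.1 =ᵐ[volume.restrict (Ioi (0 : ℝ))] y ∧ y 0 = 0 ∧ Solves V w.2 y}
  add_mem' := by
    rintro ⟨u, f⟩ ⟨v, g⟩ ⟨y, hy, hy0, hs⟩ ⟨z, hz, hz0, ht⟩
    refine ⟨y + z, (Lp.coeFn_add u v).trans (hy.add hz), by simp [hy0, hz0], ?_⟩
    exact (hs.add ht).congr (Lp.coeFn_add f g).symm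
  zero_mem' := by
    refine ⟨0, Lp.coeFn_zero _ _ _, rfl, ?_⟩
    have : Solves V 0 0 := ⟨0, fun x _ => hasDerivWithinAt_const x _ (0 : ℂ), by simp, by simp⟩
    exact this.congr (Lp.coeFn_zero _ _ _).symm
  smul_mem' := by
    rintro c ⟨u, f⟩ ⟨y, hy, hy0, hs⟩
    refine ⟨c • y, (Lp.coeFn_smul c u).trans (hy.const_smul c), by simp [hy0], ?_⟩
    exact (hs.smul c).congr (Lp.coeFn_smul c f).symm

/-- `graph V` is the graph of a (single-valued) operator. -/
theorem graph_single_valued (V : ℝ → ℂ) (w : H × H) (hw : w ∈ graph V) (h0 : w.1 = 0) :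
    w.2 = 0 := by
  obtain ⟨y, hy, hy0, p, h1, h2, h3⟩ := hw
  rw [h0] at hy
  have hyae : y =ᵐ[volume.restrict (Ioi (0 : ℝ))] fun _ => (0 : ℂ) :=
    hy.symm.trans (Lp.coeFn_zero _ _ _)
  have hyc : ContinuousOn y (Ici 0) := fun x hx => (h1 x hx).continuousWithinAt
  have hyz' : EqOn y (fun _ => (0 : ℂ)) (Ioi 0) :=
    Measure.eqOn_open_of_ae_eq hyae isOpen_Ioi (hyc.mono Ioi_subset_Ici_self)
      continuousOn_const
  have hyz : ∀ x, 0 ≤ x → y x = 0 := by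
    intro x hx
    rcases hx.eq_or_lt with rfl | hx
    · exact hy0
    · exact hyz' hx
  have hp : ∀ x, 0 ≤ x → p x = 0 := by
    intro x hx
    have hd : HasDerivWithinAt y 0 (Ici 0) x :=
      (hasDerivWithinAt_const x (Ici 0) (0 : ℂ)).congr (fun t ht => hyz t ht) (hyz x hx)
    exact (uniqueDiffOn_Ici (0 : ℝ) x hx).eq_deriv _ (h1 x hx) hd
  have hint : ∀ x, 0 ≤ x → ∫ t in (0 : ℝ)..x, (V t * y t - w.2 t) = 0 := by
    intro x hx
    have := h3 x hx
    rw [hp x hx, hp 0 le_rfl, zero_add] at this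
    exact this.symm
  have hloc : ∀ n : ℕ, ∀ᵐ x, x ∈ Ioo (0 : ℝ) n → w.2 x = 0 := by
    intro n
    have hd := (h2 n n.cast_nonneg).ae_hasDerivAt_integral
    filter_upwards [hd] with x hx hxn
    have hxn' : x ∈ uIcc (0 : ℝ) n := by
      rw [uIcc_of_le n.cast_nonneg]; exact Ioo_subset_Icc_self hxn
    have hx1 := hx hxn' 0 left_mem_uIcc
    have hx2 : HasDerivAt (fun b => ∫ t in (0 : ℝ)..b, (V t * y t - w.2 t)) 0 x := by
      refine (hasDerivAt_const x (0 : ℂ)).congr_of_eventuallyEq ?_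
      filter_upwards [lt_mem_nhds hxn.1] with b hb
      exact hint b hb.le
    have := hx1.unique hx2
    rw [hyz x hxn.1.le] at this
    simpa using this
  apply Lp.ext
  refine EventuallyEq.trans ?_ (Lp.coeFn_zero _ _ _).symm
  rw [EventuallyEq, ae_restrict_iff' measurableSet_Ioi]
  filter_upwards [ae_all_iff.2 hloc] with x hx hx0
  obtain ⟨n, hn⟩ := exists_nat_gt x
  exact hx n ⟨hx0, hn⟩

/-- The Dirichlet Schrödinger operator `L_V = -d²/dx² + V` in `L²(0, ∞)`. -/
def operator (V : ℝ → ℂ) : H →ₗ.[ℂ] H := (graph V).toLinearPMap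

theorem operator_graph (V : ℝ → ℂ) : (operator V).graph = graph V :=
  Submodule.toLinearPMap_graph_eq _ (graph_single_valued V)

/-- The kernel of `(T - z)ⁿ` for an unbounded operator `T`. -/
def kerPow {E : Type*} [AddCommGroup E] [Module ℂ E] (T : E →ₗ.[ℂ] E) (z : ℂ) :
    ℕ → Submodule ℂ E
  | 0 => ⊥
  | n + 1 => ((kerPow T z n).comap (T.toFun - z • T.domain.subtype)).map T.domain.subtype

/-- Algebraic multiplicity of `z` as an eigenvalue of `T`: the dimension of the root subspace
`⋃ₙ ker (T - z)ⁿ` (it is `0` exactly when `z` is not an eigenvalue). -/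
def algMultiplicity {E : Type*} [AddCommGroup E] [Module ℂ E] (T : E →ₗ.[ℂ] E) (z : ℂ) : ℕ∞ :=
  Cardinal.toENat (Module.rank ℂ (⨆ n, kerPow T z n : Submodule ℂ E))

/-- `y` is a Jost solution: `-y'' + V y = k² y` on `[0, ∞)` and `y(x) ~ exp(ikx)` at infinity. -/
def IsJostSolution (V : ℝ → ℂ) (k : ℂ) (y : ℝ → ℂ) : Prop :=
  Solves V (fun x => k ^ 2 * y x) y ∧
    Tendsto (fun x : ℝ => y x * Complex.exp (-(Complex.I * k * x))) atTop (𝓝 1)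

/-- The Jost solution `e(x, k)`, for `k` in the closed upper half-plane. When
`∫ (1 + x) |V| < ∞` it exists there and is unique on `[0, ∞)`. -/
def jostSolution (V : ℝ → ℂ) (k : ℂ) : ℝ → ℂ := Classical.epsilon (IsJostSolution V k)

/-- The Jost function `e(k) = e(0, k)` on the closed upper half-plane. -/
def jost (V : ℝ → ℂ) (k : ℂ) : ℂ := jostSolution V k 0

/-- The closed upper half-plane. -/
def closedUpper : Set ℂ := {k | 0 ≤ k.im}

/-- Order of vanishing at a real point `k` of a function `F` on the closed upper half-plane: the
largest `n` with `F(w) = O(|w - k|ⁿ)` as `w → k`, `Im w ≥ 0`. If `F` continues analytically to a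
neighbourhood of `k`, this is the order of the zero of the continuation. -/
def boundaryOrder (F : ℂ → ℂ) (k : ℝ) : ℕ∞ :=
  ⨆ (n : ℕ) (_ : F =O[𝓝[closedUpper] (k : ℂ)] fun w => (w - k) ^ n), (n : ℕ∞)

/-- The total multiplicity `N(V)` of the eigenvalues of `L_V` (each with its algebraic
multiplicity) and of its spectral singularities, i.e. the real zeros of the Jost function
(each with its order). -/
def totalMultiplicity (V : ℝ → ℂ) : ℝ≥0∞ :=
  (∑' z : ℂ, (algMultiplicity (operator V) z : ℝ≥0∞)) +
    ∑' k : ℝ, (boundaryOrder (jost V) k : ℝ≥0∞)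

/-- `R`: the minimal radius of a disc about the origin that contains all zeros of the Jost
function in the closed upper half-plane. -/
def zeroRadius (V : ℝ → ℂ) : ℝ :=
  sInf {r : ℝ | 0 ≤ r ∧ ∀ k ∈ closedUpper, jost V k = 0 → ‖k‖ ≤ r}

/-- `R̃(α) = ((1 / ln 2) ∫₀^∞ (2x)^α |V(x)| dx)^(1 / (1 - α))`. -/
def radiusBound (V : ℝ → ℂ) (α : ℝ) : ℝ :=
  (1 / Real.log 2 * ∫ x in Ioi (0 : ℝ), (2 * x) ^ α * ‖V x‖) ^ (1 / (1 - α))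

end HalfLineSchrodinger

end

/-!
Write the Jost solution as `e(x, k) = e^{ikx} m(x, k)`, where the Jost factor `m` is the Neumann
series of a Volterra equation on `[x, ∞)`. Exponential decay of `V` makes `m(0, ·)`, which extends
the Jost function `e`, analytic in `Im k > -a / 2`.

If `u` is a root vector of order `n` at `z = k²`, `Im k > 0`, then iterating Green's identity for
`u` and `e(·, κ)` gives `(κ² - z)ⁿ ∫ e(·, κ) u = -e(κ) P(κ² - z)` with a polynomial `P` that does
not vanish at `0`. Hence `e(κ) = O((κ - k)ⁿ)` at `k`. As `L_V - z` has a kernel of dimension at most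
one, the algebraic multiplicity of `z` is therefore at most the order of the zero `k`, and `N(V)` is
at most the number of zeros of `e` in the closed upper half-plane.

These zeros lie in the disc of radius `√(A² + R²)` about `iA`, and Jensen's formula on the
concentric disc of radius `A + b` counts them: the Neumann series gives
`|e(iA)| ≥ 2 - 2 ^ ((R̃(α) / A) ^ (1 - α))` at the centre and
`|e| ≤ exp ((2b) ^ (β - 1) ∫ x^β (1 + e^{ax}) |V|)` on the boundary. Finally let `b` tend
to `a / 2`.
-/

noncomputable section

namespace HalfLineSchrodinger

section Primitive

variable {E : Type*} [NormedAddCommGroup E] [NormedSpace ℝ E] {U W u w : ℝ → E}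

/-- `U` is locally absolutely continuous on `[0, ∞)` with almost everywhere derivative `u`,
expressed by `U` being an indefinite integral of `u`. -/
structure IsPrimitive (U u : ℝ → E) : Prop where
  intervalIntegrable_zero : ∀ x, 0 ≤ x → IntervalIntegrable u volume 0 x
  eq_add_integral : ∀ x, 0 ≤ x → U x = U 0 + ∫ t in (0 : ℝ)..x, u t

theorem isPrimitive_integral (hu : ∀ x, 0 ≤ x → IntervalIntegrable u volume 0 x) :
    IsPrimitive (fun x => ∫ t in (0 : ℝ)..x, u t) u :=
  ⟨hu, fun x _ => by simp⟩

theorem isPrimitive_integral_Ioi (hu : IntegrableOn u (Ioi 0)) :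
    IsPrimitive (fun x => ∫ t in Ioi x, u t) (fun x => -u x) where
  intervalIntegrable_zero x hx :=
    ((intervalIntegrable_iff_integrableOn_Ioc_of_le hx).2
      (hu.mono_set Ioc_subset_Ioi_self)).neg
  eq_add_integral x hx := by
    rw [intervalIntegral.integral_neg, ← intervalIntegral.integral_interval_add_Ioi hu
      (hu.mono_set (Ioi_subset_Ioi hx))]
    abel

namespace IsPrimitive

theorem sub_eq_integral (h : IsPrimitive U u) {x y : ℝ} (hx : 0 ≤ x) (hy : 0 ≤ y) :
    U y - U x = ∫ t in x..y, u t := by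
  rw [h.eq_add_integral x hx, h.eq_add_integral y hy, add_sub_add_left_eq_sub,
    intervalIntegral.integral_interval_sub_left (h.intervalIntegrable_zero y hy)
      (h.intervalIntegrable_zero x hx)]

theorem absolutelyContinuousOnInterval (h : IsPrimitive U u) {X : ℝ} (hX : 0 ≤ X) :
    AbsolutelyContinuousOnInterval U 0 X := by
  have hnorm : AbsolutelyContinuousOnInterval (fun x => ∫ t in (0 : ℝ)..x, ‖u t‖) 0 X :=
    (h.intervalIntegrable_zero X hX).norm.absolutelyContinuousOnInterval_intervalIntegral
      left_mem_uIcc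
  unfold AbsolutelyContinuousOnInterval at hnorm ⊢
  refine squeeze_zero' (.of_forall fun _ => Finset.sum_nonneg fun _ _ => dist_nonneg) ?_ hnorm
  refine eventually_inf_principal.2 (.of_forall fun I hI => Finset.sum_le_sum fun i hi => ?_)
  obtain ⟨hx, hy⟩ := hI.1 i hi
  rw [uIcc_of_le hX] at hx hy
  rw [dist_comm, dist_eq_norm, dist_comm, Real.dist_eq, h.sub_eq_integral hx.1 hy.1,
    intervalIntegral.integral_interval_sub_left (h.intervalIntegrable_zero _ hy.1).norm
      (h.intervalIntegrable_zero _ hx.1).norm]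
  exact intervalIntegral.norm_integral_le_abs_integral_norm

theorem continuousOn (h : IsPrimitive U u) : ContinuousOn U (Ici 0) := by
  intro x (hx : 0 ≤ x)
  have hac := h.absolutelyContinuousOnInterval (add_nonneg hx zero_le_one)
  have hc : ContinuousOn U (Icc 0 (x + 1)) := by
    simpa only [uIcc_of_le (add_nonneg hx zero_le_one)] using hac.continuousOn
  exact (hc x ⟨hx, by linarith⟩).mono_of_mem_nhdsWithin <| by
    rw [← Ici_inter_Iic]
    exact inter_mem_nhdsWithin _ (Iic_mem_nhds (by linarith))

theorem ae_hasDerivAt [CompleteSpace E] (h : IsPrimitive U u) :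
    ∀ᵐ x, 0 < x → HasDerivAt U (u x) x := by
  have hloc (n : ℕ) : ∀ᵐ x, x ∈ Ioo (0 : ℝ) n → HasDerivAt U (u x) x := by
    filter_upwards [(h.intervalIntegrable_zero n n.cast_nonneg).ae_hasDerivAt_integral]
      with x hx hxn
    have hd := (hx (by rw [uIcc_of_le n.cast_nonneg]; exact Ioo_subset_Icc_self hxn) 0
      left_mem_uIcc).const_add (U 0)
    refine hd.congr_of_eventuallyEq ?_
    filter_upwards [lt_mem_nhds hxn.1] with b hb
    exact h.eq_add_integral b hb.le
  filter_upwards [ae_all_iff.2 hloc] with x hx hx0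
  obtain ⟨n, hn⟩ := exists_nat_gt x
  exact hx n ⟨hx0, hn⟩

theorem of_absolutelyContinuousOnInterval [CompleteSpace E]
    (hU : ∀ X, 0 ≤ X → AbsolutelyContinuousOnInterval U 0 X)
    (hu : ∀ X, 0 ≤ X → IntervalIntegrable u volume 0 X)
    (hd : ∀ᵐ x, 0 < x → HasDerivAt U (u x) x) : IsPrimitive U u := by
  refine ⟨hu, fun X hX => ?_⟩
  set P : ℝ → E := fun x => ∫ t in (0 : ℝ)..x, u t
  have hP : IsPrimitive P u := isPrimitive_integral hu
  have hderiv : ∀ᵐ x, x ∈ uIcc 0 X → HasDerivAt (U - P) 0 x := by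
    filter_upwards [hd, hP.ae_hasDerivAt, Measure.ae_ne volume 0] with x hUx hPx hx0 hx
    rw [uIcc_of_le hX] at hx
    have hx0 : 0 < x := hx.1.lt_of_ne' hx0
    simpa only [sub_self] using (hUx hx0).sub (hPx hx0)
  obtain ⟨C, hC⟩ := ((hU X hX).sub
    (hP.absolutelyContinuousOnInterval hX)).const_of_ae_hasDerivAt_zero hderiv
  have hdiff : U X - P X = U 0 - P 0 := (hC X right_mem_uIcc).trans (hC 0 left_mem_uIcc).symm
  have hP0 : P 0 = 0 := intervalIntegral.integral_same
  rw [hP0, sub_zero] at hdiff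
  rw [← hdiff, sub_add_cancel]

theorem of_hasDerivWithinAt [CompleteSpace E]
    (hd : ∀ x, 0 ≤ x → HasDerivWithinAt U (u x) (Ici 0) x) (hc : ContinuousOn u (Ici 0)) :
    IsPrimitive U u := by
  have hi (x : ℝ) (hx : 0 ≤ x) : IntervalIntegrable u volume 0 x :=
    (hc.mono (by rw [uIcc_of_le hx]; exact Icc_subset_Ici_self)).intervalIntegrable
  refine ⟨hi, fun x hx => ?_⟩
  rw [intervalIntegral.integral_eq_sub_of_hasDerivAt_of_le hx
    (fun t ht => (hd t ht.1).continuousWithinAt.mono Icc_subset_Ici_self)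
    (fun t ht => (hd t ht.1.le).hasDerivAt (Ici_mem_nhds ht.1)) (hi x hx)]
  abel

theorem congr_ae (h : IsPrimitive U u) (huw : u =ᵐ[volume.restrict (Ioi (0 : ℝ))] w) :
    IsPrimitive U w := by
  have key (x : ℝ) (hx : 0 ≤ x) : u =ᵐ[volume.restrict (uIoc 0 x)] w := by
    rw [uIoc_of_le hx]
    exact ae_restrict_of_ae_restrict_of_subset Ioc_subset_Ioi_self huw
  refine ⟨fun x hx => (h.intervalIntegrable_zero x hx).congr_ae (key x hx), fun x hx => ?_⟩
  rw [h.eq_add_integral x hx, intervalIntegral.integral_congr_ae_restrict (key x hx)]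

theorem congr (h : IsPrimitive U u) (huw : ∀ x, 0 < x → u x = w x) : IsPrimitive U w :=
  h.congr_ae ((ae_restrict_mem measurableSet_Ioi).mono huw)

theorem sub (h : IsPrimitive U u) (h' : IsPrimitive W w) :
    IsPrimitive (fun x => U x - W x) (fun x => u x - w x) where
  intervalIntegrable_zero x hx :=
    (h.intervalIntegrable_zero x hx).sub (h'.intervalIntegrable_zero x hx)
  eq_add_integral x hx := by
    rw [intervalIntegral.integral_sub (h.intervalIntegrable_zero x hx)
      (h'.intervalIntegrable_zero x hx), h.eq_add_integral x hx, h'.eq_add_integral x hx]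
    abel

theorem integral_Ioi (h : IsPrimitive U u) {x : ℝ} (hx : 0 ≤ x) (hu : IntegrableOn u (Ioi x))
    {l : E} (hl : Tendsto U atTop (𝓝 l)) : ∫ t in Ioi x, u t = l - U x := by
  refine tendsto_nhds_unique (intervalIntegral_tendsto_integral_Ioi x hu tendsto_id)
    ((hl.sub_const (U x)).congr' ?_)
  filter_upwards [eventually_ge_atTop 0] with y hy using h.sub_eq_integral hx hy

section NormedField

variable {𝕜 : Type*} [NormedField 𝕜] [NormedAlgebra ℝ 𝕜] {U W u w : ℝ → 𝕜}

theorem const_mul (h : IsPrimitive U u) (c : 𝕜) :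
    IsPrimitive (fun x => c * U x) (fun x => c * u x) where
  intervalIntegrable_zero x hx := (h.intervalIntegrable_zero x hx).const_mul c
  eq_add_integral x hx := by
    rw [h.eq_add_integral x hx, mul_add, ← smul_eq_mul c (∫ t in (0 : ℝ)..x, u t),
      ← intervalIntegral.integral_smul]
    rfl

theorem mul [CompleteSpace 𝕜] (h : IsPrimitive U u) (h' : IsPrimitive W w) :
    IsPrimitive (fun x => U x * W x) (fun x => u x * W x + U x * w x) := by
  refine of_absolutelyContinuousOnInterval
    (fun X hX => (h.absolutelyContinuousOnInterval hX).smul (h'.absolutelyContinuousOnInterval hX))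
    (fun X hX => ?_) ?_
  · have hs : uIcc 0 X ⊆ Ici 0 := by rw [uIcc_of_le hX]; exact Icc_subset_Ici_self
    exact ((h.intervalIntegrable_zero X hX).mul_continuousOn (h'.continuousOn.mono hs)).add
      ((h'.intervalIntegrable_zero X hX).continuousOn_mul (h.continuousOn.mono hs))
  · filter_upwards [h.ae_hasDerivAt, h'.ae_hasDerivAt] with x hU hW hx
    exact (hU hx).mul (hW hx)

theorem pow_succ [CompleteSpace 𝕜] (h : IsPrimitive U u) (n : ℕ) :
    IsPrimitive (fun x => U x ^ (n + 1)) (fun x => (n + 1) * (u x * U x ^ n)) := by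
  induction n with
  | zero => simpa using h
  | succ n ih =>
    have hmul := ih.mul h
    simp only [← _root_.pow_succ] at hmul
    refine hmul.congr fun x _ => ?_
    push_cast
    ring

end NormedField

end IsPrimitive

theorem tendsto_integral_Ioi_atTop {u : ℝ → E} (hu : IntegrableOn u (Ioi 0)) :
    Tendsto (fun x => ∫ t in Ioi x, u t) atTop (𝓝 0) := by
  have hlim := (intervalIntegral_tendsto_integral_Ioi 0 hu tendsto_id).const_sub
    (∫ t in Ioi 0, u t)
  rw [sub_self] at hlim
  refine hlim.congr' ?_
  filter_upwards [eventually_ge_atTop 0] with x hx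
  rw [← intervalIntegral.integral_interval_add_Ioi hu (hu.mono_set (Ioi_subset_Ioi hx)),
    id, add_sub_cancel_left]

theorem integrableOn_mul_tail_pow {q : ℝ → ℝ} (hq : IntegrableOn q (Ioi 0)) (n : ℕ) :
    IntegrableOn (fun t => q t * (∫ s in Ioi t, q s) ^ n) (Ioi 0) := by
  have hc := (isPrimitive_integral_Ioi hq).continuousOn.pow n
  refine hq.mul_bdd (c := (∫ s in Ioi 0, |q s|) ^ n)
    ((hc.mono Ioi_subset_Ici_self).aestronglyMeasurable measurableSet_Ioi) ?_
  filter_upwards [ae_restrict_mem measurableSet_Ioi] with t ht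
  rw [norm_pow]
  gcongr
  exact (norm_integral_le_integral_norm q).trans <| setIntegral_mono_set hq.norm
    (.of_forall fun _ => norm_nonneg _) (Ioi_subset_Ioi (le_of_lt ht)).eventuallyLE

theorem integral_mul_tail_pow {q : ℝ → ℝ} (hq : IntegrableOn q (Ioi 0)) (n : ℕ) {x : ℝ}
    (hx : 0 ≤ x) :
    ∫ t in Ioi x, q t * (∫ s in Ioi t, q s) ^ n = (∫ t in Ioi x, q t) ^ (n + 1) / (n + 1) := by
  have hprim := (isPrimitive_integral_Ioi hq).pow_succ n
  have hint : IntegrableOn (fun t => (n + 1) * (-q t * (∫ s in Ioi t, q s) ^ n)) (Ioi x) := by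
    simp only [neg_mul]
    exact ((integrableOn_mul_tail_pow hq n).mono_set (Ioi_subset_Ioi hx)).neg.const_mul _
  have hlim : Tendsto (fun x => (∫ t in Ioi x, q t) ^ (n + 1)) atTop (𝓝 0) := by
    simpa only [zero_pow n.succ_ne_zero] using (tendsto_integral_Ioi_atTop hq).pow (n + 1)
  have h := hprim.integral_Ioi hx hint hlim
  simp only [neg_mul, integral_const_mul, integral_neg] at h
  field_simp
  linarith

theorem le_mul_pow_div_factorial_of_le_integral {q N : ℝ → ℝ} {X M : ℝ}
    (hq : ∀ x, 0 ≤ x → IntervalIntegrable q volume 0 x) (hq0 : ∀ x, 0 ≤ q x)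
    (hN : ContinuousOn N (Ici 0)) (h : ∀ x, 0 ≤ x → N x ≤ ∫ t in (0 : ℝ)..x, q t * N t)
    (hM : ∀ x ∈ Icc 0 X, N x ≤ M) (n : ℕ) :
    ∀ x ∈ Icc 0 X, N x ≤ M * ((∫ t in (0 : ℝ)..x, q t) ^ n / n.factorial) := by
  have hQ := isPrimitive_integral hq
  induction n with
  | zero => simpa using hM
  | succ n ih =>
    intro x hx
    have hsub : uIcc 0 x ⊆ Icc 0 X := by
      rw [uIcc_of_le hx.1]
      exact Icc_subset_Icc_right hx.2
    have hpow : ∫ t in (0 : ℝ)..x, (n + 1) * (q t * (∫ s in (0 : ℝ)..t, q s) ^ n) =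
        (∫ t in (0 : ℝ)..x, q t) ^ (n + 1) := by
      simpa using ((hQ.pow_succ n).sub_eq_integral le_rfl hx.1).symm
    calc N x ≤ ∫ t in (0 : ℝ)..x, q t * N t := h x hx.1
      _ ≤ ∫ t in (0 : ℝ)..x, M / (n + 1).factorial *
          ((n + 1) * (q t * (∫ s in (0 : ℝ)..t, q s) ^ n)) := by
        refine intervalIntegral.integral_mono_on hx.1 ((hq x hx.1).mul_continuousOn
          (hN.mono (hsub.trans Icc_subset_Ici_self)))
          (((hQ.pow_succ n).intervalIntegrable_zero x hx.1).const_mul _) fun t ht => ?_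
        calc q t * N t ≤ q t * (M * ((∫ s in (0 : ℝ)..t, q s) ^ n / n.factorial)) :=
              mul_le_mul_of_nonneg_left (ih t (hsub (by rwa [uIcc_of_le hx.1]))) (hq0 t)
          _ = _ := by
            rw [Nat.factorial_succ]
            push_cast
            field
      _ = M * ((∫ t in (0 : ℝ)..x, q t) ^ (n + 1) / (n + 1).factorial) := by
        rw [intervalIntegral.integral_const_mul, hpow]
        ring

theorem eq_zero_of_le_integral {q N : ℝ → ℝ}
    (hq : ∀ x, 0 ≤ x → IntervalIntegrable q volume 0 x) (hq0 : ∀ x, 0 ≤ q x)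
    (hN : ContinuousOn N (Ici 0)) (hN0 : ∀ x, 0 ≤ x → 0 ≤ N x)
    (h : ∀ x, 0 ≤ x → N x ≤ ∫ t in (0 : ℝ)..x, q t * N t) {x : ℝ} (hx : 0 ≤ x) : N x = 0 := by
  obtain ⟨y, -, hmax⟩ := isCompact_Icc.exists_isMaxOn (nonempty_Icc.2 hx)
    (hN.mono Icc_subset_Ici_self)
  have hlim : Tendsto (fun n : ℕ => N y * ((∫ t in (0 : ℝ)..x, q t) ^ n / n.factorial)) atTop
      (𝓝 0) := by
    simpa using (FloorSemiring.tendsto_pow_div_factorial_atTop _).const_mul (N y)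
  refine le_antisymm (ge_of_tendsto' hlim fun n => ?_) (hN0 x hx)
  exact le_mul_pow_div_factorial_of_le_integral hq hq0 hN h (fun z hz => hmax hz) n x ⟨hx, le_rfl⟩

end Primitive

theorem aestronglyMeasurable_of_hasDerivAt {α 𝕜 E : Type*} [MeasurableSpace α] {μ : Measure α}
    [NontriviallyNormedField 𝕜] [NormedAddCommGroup E] [NormedSpace 𝕜 E] {F : 𝕜 → α → E}
    {F' : α → E} {k : 𝕜} (hm : ∀ᶠ z in 𝓝 k, AEStronglyMeasurable (F z) μ)
    (hd : ∀ᵐ t ∂μ, HasDerivAt (fun z => F z t) (F' t) k) : AEStronglyMeasurable F' μ := by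
  obtain ⟨z, hzk, hz⟩ := exists_seq_forall_of_frequently
    (hm.filter_mono (nhdsWithin_le_nhds (s := {k}ᶜ))).frequently
  refine aestronglyMeasurable_of_tendsto_ae atTop (f := fun n t => slope (fun w => F w t) k (z n))
    (fun n => ((hz n).sub hm.self_of_nhds).const_smul _) ?_
  filter_upwards [hd] with t ht using (hasDerivAt_iff_tendsto_slope.1 ht).comp hzk

theorem differentiableOn_integral_of_norm_le {α E : Type*} [MeasurableSpace α] {μ : Measure α}
    [NormedAddCommGroup E] [NormedSpace ℂ E] {s : Set ℂ} (hs : IsOpen s)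
    {F : ℂ → α → E} {g : α → ℝ} (hm : ∀ k ∈ s, AEStronglyMeasurable (F k) μ)
    (hd : ∀ᵐ t ∂μ, DifferentiableOn ℂ (fun k => F k t) s)
    (hb : ∀ᵐ t ∂μ, ∀ k ∈ s, ‖F k t‖ ≤ g t) (hg : Integrable g μ) :
    DifferentiableOn ℂ (fun k => ∫ t, F k t ∂μ) s := by
  intro k₀ hk₀
  obtain ⟨ε, hε, hball⟩ := Metric.isOpen_iff.1 hs k₀ hk₀
  have hr : 0 < ε / 2 := half_pos hε
  have hsub (k : ℂ) (hk : k ∈ Metric.ball k₀ (ε / 2)) : Metric.closedBall k (ε / 2) ⊆ s := by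
    refine (Metric.closedBall_subset_ball' ?_).trans hball
    linarith [Metric.mem_ball.1 hk]
  have hball' : Metric.ball k₀ (ε / 2) ⊆ s :=
    (Metric.ball_subset_ball (by linarith)).trans hball
  have hderiv : ∀ᵐ t ∂μ, ∀ k ∈ Metric.ball k₀ (ε / 2),
      HasDerivAt (fun k => F k t) (deriv (fun k => F k t) k) k := by
    filter_upwards [hd] with t ht k hk
    exact ((ht k (hball' hk)).differentiableAt (hs.mem_nhds (hball' hk))).hasDerivAt
  have hcauchy : ∀ᵐ t ∂μ, ∀ k ∈ Metric.ball k₀ (ε / 2),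
      ‖deriv (fun k => F k t) k‖ ≤ g t / (ε / 2) := by
    filter_upwards [hd, hb] with t ht hgt k hk
    refine Complex.norm_deriv_le_of_forall_mem_sphere_norm_le hr ?_ fun z hz =>
      hgt z (hsub k hk (Metric.sphere_subset_closedBall hz))
    refine (ht.mono ?_).diffContOnCl
    rw [closure_ball k hr.ne']
    exact hsub k hk
  have hmeas : ∀ᶠ k in 𝓝 k₀, AEStronglyMeasurable (F k) μ := by
    filter_upwards [hs.mem_nhds hk₀] with k hk using hm k hk
  exact (hasDerivAt_integral_of_dominated_loc_of_deriv_le (Metric.ball_mem_nhds k₀ hr) hmeas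
    (hg.mono' (hm k₀ hk₀) (hb.mono fun t ht => ht k₀ hk₀))
    (aestronglyMeasurable_of_hasDerivAt hmeas
      (hderiv.mono fun t ht => ht k₀ (Metric.mem_ball_self hr)))
    hcauchy (hg.div_const _) hderiv).2.differentiableAt.differentiableWithinAt

/-- The kernel `∫₀ˢ e^{2iku} du = (e^{2iks} - 1) / (2ik)` of the Volterra equation for the Jost
solution. The divided slope of `exp` makes it entire in `k`. -/
def volterraKernel (k : ℂ) (s : ℝ) : ℂ :=
  s * dslope Complex.exp 0 (2 * Complex.I * k * s)

section Kernel

variable {k : ℂ} {a s t : ℝ}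

theorem two_I_mul_volterraKernel (k : ℂ) (s : ℝ) :
    2 * Complex.I * k * volterraKernel k s = Complex.exp (2 * Complex.I * k * s) - 1 := by
  have h := sub_smul_dslope Complex.exp 0 (2 * Complex.I * k * s)
  rw [sub_zero, smul_eq_mul, Complex.exp_zero] at h
  rw [← h, volterraKernel]
  ring

@[simp]
theorem volterraKernel_zero_left (s : ℝ) : volterraKernel 0 s = s := by
  simp [volterraKernel]

@[simp]
theorem volterraKernel_zero_right (k : ℂ) : volterraKernel k 0 = 0 := by
  simp [volterraKernel]

theorem differentiable_volterraKernel (s : ℝ) : Differentiable ℂ fun k => volterraKernel k s := by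
  have hslope : Differentiable ℂ (dslope Complex.exp 0) := by
    rw [← differentiableOn_univ, Complex.differentiableOn_dslope univ_mem]
    exact Complex.differentiable_exp.differentiableOn
  have hlin : Differentiable ℂ fun k : ℂ => 2 * Complex.I * k * s := by fun_prop
  exact (hslope.comp hlin).const_mul _

theorem hasDerivAt_volterraKernel (k : ℂ) (s : ℝ) :
    HasDerivAt (volterraKernel k) (Complex.exp (2 * Complex.I * k * s)) s := by
  rcases eq_or_ne k 0 with rfl | hk
  · simpa using (hasDerivAt_id s).ofReal_comp.congr_of_eventuallyEq
      (.of_forall volterraKernel_zero_left)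
  · have h2k : 2 * Complex.I * k ≠ 0 := by simp [hk]
    have hlin : HasDerivAt (fun s : ℝ => 2 * Complex.I * k * (s : ℂ)) (2 * Complex.I * k) s := by
      simpa using (hasDerivAt_id s).ofReal_comp.const_mul (2 * Complex.I * k)
    have hdiv := (hlin.cexp.sub_const 1).div_const (2 * Complex.I * k)
    rw [mul_div_cancel_right₀ _ h2k] at hdiv
    exact hdiv.congr_of_eventuallyEq
      (.of_forall fun s => eq_div_of_mul_eq h2k (by rw [mul_comm, two_I_mul_volterraKernel]))

theorem continuous_volterraKernel (k : ℂ) : Continuous (volterraKernel k) :=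
  continuous_iff_continuousAt.2 fun s => (hasDerivAt_volterraKernel k s).continuousAt

theorem norm_cexp_two_I_mul (k : ℂ) (s : ℝ) :
    ‖Complex.exp (2 * Complex.I * k * s)‖ = Real.exp (-2 * k.im * s) := by
  simp [Complex.norm_exp]

theorem norm_cexp_two_I_mul_le (hk : -(a / 2) ≤ k.im) (hs : 0 ≤ s) :
    ‖Complex.exp (2 * Complex.I * k * s)‖ ≤ Real.exp (a * s) := by
  rw [norm_cexp_two_I_mul]
  gcongr
  linarith

theorem norm_volterraKernel_le_mul_exp (ha : 0 ≤ a) (hk : -(a / 2) ≤ k.im) (hs : 0 ≤ s) :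
    ‖volterraKernel k s‖ ≤ s * Real.exp (a * s) := by
  have h := (convex_Icc 0 s).norm_image_sub_le_of_norm_hasDerivWithin_le
    (fun u _ => (hasDerivAt_volterraKernel k u).hasDerivWithinAt)
    (fun u hu => (norm_cexp_two_I_mul_le hk hu.1).trans
      (Real.exp_le_exp.2 (mul_le_mul_of_nonneg_left hu.2 ha)))
    (left_mem_Icc.2 hs) (right_mem_Icc.2 hs)
  rwa [volterraKernel_zero_right, sub_zero, sub_zero, Real.norm_of_nonneg hs, mul_comm] at h

theorem norm_volterraKernel_le_div (hk0 : k ≠ 0) (hk : -(a / 2) ≤ k.im) (hs : 0 ≤ s) :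
    ‖volterraKernel k s‖ ≤ (1 + Real.exp (a * s)) / (2 * ‖k‖) := by
  rw [le_div_iff₀' (by positivity)]
  calc 2 * ‖k‖ * ‖volterraKernel k s‖ = ‖Complex.exp (2 * Complex.I * k * s) - 1‖ := by
        rw [← two_I_mul_volterraKernel]
        simp
    _ ≤ ‖Complex.exp (2 * Complex.I * k * s)‖ + ‖(1 : ℂ)‖ := norm_sub_le _ _
    _ ≤ 1 + Real.exp (a * s) := by
        rw [norm_one, add_comm]
        gcongr
        exact norm_cexp_two_I_mul_le hk hs

theorem norm_volterraKernel_le_rpow {c β : ℝ} (ha : 0 ≤ a) (hk : -(a / 2) ≤ k.im) (hs : 0 ≤ s)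
    (hc : 0 < c) (hkc : c ≤ ‖k‖) (hβ : β ∈ Icc (0 : ℝ) 1) :
    ‖volterraKernel k s‖ ≤ 1 / (2 * c) ^ (1 - β) * (s ^ β * (1 + Real.exp (a * s))) := by
  set G := 1 + Real.exp (a * s)
  set D := ‖volterraKernel k s‖
  have hG : 0 < G := by positivity
  have hDs : D ≤ s * G := (norm_volterraKernel_le_mul_exp ha hk hs).trans
    (mul_le_mul_of_nonneg_left (by simp [G]) hs)
  have hDc : D ≤ G / (2 * c) :=
    (norm_volterraKernel_le_div (norm_pos_iff.1 (hc.trans_le hkc)) hk hs).trans (by gcongr)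
  have hβ' : 0 ≤ 1 - β := sub_nonneg.2 hβ.2
  have hGβ : G ^ β * G ^ (1 - β) = G := by
    rw [← Real.rpow_add hG, add_sub_cancel, Real.rpow_one]
  calc D = D ^ β * D ^ (1 - β) := by
        rw [← Real.rpow_add_of_nonneg (norm_nonneg _) hβ.1 hβ', add_sub_cancel, Real.rpow_one]
    _ ≤ (s * G) ^ β * (G / (2 * c)) ^ (1 - β) := by
        gcongr
        exact hβ.1
    _ = 1 / (2 * c) ^ (1 - β) * (s ^ β * (G ^ β * G ^ (1 - β))) := by
        rw [Real.mul_rpow hs hG.le, Real.div_rpow hG.le (by positivity)]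
        ring
    _ = 1 / (2 * c) ^ (1 - β) * (s ^ β * G) := by rw [hGβ]

end Kernel

/-- An integrable majorant `q` of the kernel of the Volterra operator with potential `V` at the
spectral parameter `k`; here `s = t - x` for `0 ≤ x ≤ t`. -/
structure KernelBound (V : ℝ → ℂ) (k : ℂ) (q : ℝ → ℝ) : Prop where
  integrableOn : IntegrableOn q (Ioi 0)
  aestronglyMeasurable_potential : AEStronglyMeasurable V (volume.restrict (Ioi 0))
  norm_le : ∀ s t, 0 ≤ s → s ≤ t → ‖volterraKernel k s‖ * ‖V t‖ ≤ q t

/-- The Volterra operator `f ↦ ∫ₓ^∞ D(t - x) V(t) f(t) dt`, where `D = volterraKernel k`. Since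
`D 0 = 0`, the `max` makes the domain of integration independent of `x ≥ 0`. -/
def volterra (V : ℝ → ℂ) (k : ℂ) (f : ℝ → ℂ) (x : ℝ) : ℂ :=
  ∫ t in Ioi (0 : ℝ), volterraKernel k (max (t - x) 0) * V t * f t

/-- The tail integral `∫ₓ^∞ q`. -/
def tail (q : ℝ → ℝ) (x : ℝ) : ℝ := ∫ s in Ioi x, q s

/-- The terms of the Neumann series of the Volterra equation `m = 1 + volterra V k m`. -/
def jostTerm (V : ℝ → ℂ) (k : ℂ) : ℕ → ℝ → ℂ
  | 0 => 1
  | n + 1 => volterra V k (jostTerm V k n)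

/-- The Jost factor `m(x, k) = e^{-ikx} e(x, k)`, as a Neumann series. Unlike the Jost solution
it is also meaningful below the real axis, as far as the potential decays exponentially. -/
def jostFactor (V : ℝ → ℂ) (k : ℂ) (x : ℝ) : ℂ := ∑' n, jostTerm V k n x

namespace KernelBound

variable {V f : ℝ → ℂ} {k : ℂ} {q : ℝ → ℝ} {x t C : ℝ}

theorem nonneg (h : KernelBound V k q) (ht : 0 ≤ t) : 0 ≤ q t := by
  simpa using h.norm_le 0 t le_rfl ht

theorem tail_nonneg (h : KernelBound V k q) (hx : 0 ≤ x) : 0 ≤ tail q x :=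
  setIntegral_nonneg measurableSet_Ioi fun _ ht => h.nonneg (hx.trans (le_of_lt ht))

theorem tail_le (h : KernelBound V k q) (hx : 0 ≤ x) : tail q x ≤ tail q 0 :=
  setIntegral_mono_set h.integrableOn
    ((ae_restrict_mem measurableSet_Ioi).mono fun _ ht => h.nonneg (le_of_lt ht))
    (Ioi_subset_Ioi hx).eventuallyLE

theorem norm_kernel_le_indicator (h : KernelBound V k q) (hx : 0 ≤ x) (t : ℝ) :
    ‖volterraKernel k (max (t - x) 0) * V t‖ ≤ (Ioi x).indicator q t := by
  rw [norm_mul]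
  by_cases hxt : t ∈ Ioi x
  · rw [indicator_of_mem hxt, max_eq_left (sub_nonneg.2 (le_of_lt hxt))]
    exact h.norm_le _ t (sub_nonneg.2 (le_of_lt hxt)) (sub_le_self t hx)
  · rw [indicator_of_notMem hxt, max_eq_right (sub_nonpos.2 (not_lt.1 hxt)),
      volterraKernel_zero_right, norm_zero, zero_mul]

theorem norm_kernel_mul_le (h : KernelBound V k q) (hx : 0 ≤ x) (ht : 0 ≤ t) {z : ℂ}
    (hz : ‖z‖ ≤ C) : ‖volterraKernel k (max (t - x) 0) * V t * z‖ ≤ q t * C := by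
  rw [norm_mul]
  exact mul_le_mul ((h.norm_kernel_le_indicator hx t).trans
    (indicator_le_self' (fun _ _ => h.nonneg ht) t)) hz (norm_nonneg z) (h.nonneg ht)

theorem aestronglyMeasurable (h : KernelBound V k q) (x : ℝ)
    (hf : AEStronglyMeasurable f (volume.restrict (Ioi 0))) :
    AEStronglyMeasurable (fun t => volterraKernel k (max (t - x) 0) * V t * f t)
      (volume.restrict (Ioi 0)) :=
  (((continuous_volterraKernel k).comp (by fun_prop)).aestronglyMeasurable.mul
    h.aestronglyMeasurable_potential).mul hf

theorem norm_volterra_le (h : KernelBound V k q) (hx : 0 ≤ x) {g : ℝ → ℝ}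
    (hg : IntegrableOn (fun t => q t * g t) (Ioi 0)) (hfg : ∀ t, 0 ≤ t → ‖f t‖ ≤ g t) :
    ‖volterra V k f x‖ ≤ ∫ t in Ioi x, q t * g t := by
  rw [← inter_eq_right.2 (Ioi_subset_Ioi hx), ← setIntegral_indicator measurableSet_Ioi]
  refine norm_integral_le_of_norm_le (hg.indicator measurableSet_Ioi) ?_
  filter_upwards [ae_restrict_mem measurableSet_Ioi] with t ht
  rw [norm_mul, indicator_mul_left]
  exact mul_le_mul (h.norm_kernel_le_indicator hx t) (hfg t (le_of_lt ht))
    (norm_nonneg _) (indicator_nonneg (fun u hu => h.nonneg (hx.trans (le_of_lt hu))) t)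

theorem continuousOn_volterra (h : KernelBound V k q)
    (hf : AEStronglyMeasurable f (volume.restrict (Ioi 0))) (hC : ∀ t, 0 ≤ t → ‖f t‖ ≤ C) :
    ContinuousOn (volterra V k f) (Ici 0) := by
  refine continuousOn_of_dominated (bound := fun t => q t * C)
    (fun x _ => h.aestronglyMeasurable x hf) (fun x hx => ?_) (h.integrableOn.mul_const C)
    (.of_forall fun t => ?_)
  · filter_upwards [ae_restrict_mem measurableSet_Ioi] with t ht
    exact h.norm_kernel_mul_le hx (le_of_lt ht) (hC t (le_of_lt ht))
  · exact ((((continuous_volterraKernel k).comp (by fun_prop)).mul_const _).mul_const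
      _).continuousOn

theorem norm_jostTerm_le (h : KernelBound V k q) (n : ℕ) (hx : 0 ≤ x) :
    ‖jostTerm V k n x‖ ≤ tail q x ^ n / n.factorial := by
  induction n generalizing x with
  | zero => simp [jostTerm]
  | succ n ih =>
    have hint := (integrableOn_mul_tail_pow h.integrableOn n).div_const (n.factorial : ℝ)
    simp only [mul_div_assoc] at hint
    calc ‖volterra V k (jostTerm V k n) x‖
        ≤ ∫ t in Ioi x, q t * (tail q t ^ n / n.factorial) :=
          h.norm_volterra_le hx hint fun t ht => ih ht
      _ = tail q x ^ (n + 1) / (n + 1).factorial := by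
          simp only [← mul_div_assoc, integral_div, tail]
          rw [integral_mul_tail_pow h.integrableOn n hx, Nat.factorial_succ]
          push_cast
          field

theorem norm_jostTerm_le_const (h : KernelBound V k q) (n : ℕ) (hx : 0 ≤ x) :
    ‖jostTerm V k n x‖ ≤ tail q 0 ^ n / n.factorial := by
  have := h.tail_nonneg hx
  exact (h.norm_jostTerm_le n hx).trans (by gcongr; exact h.tail_le hx)

theorem continuousOn_jostTerm (h : KernelBound V k q) :
    ∀ n, ContinuousOn (jostTerm V k n) (Ici 0)
  | 0 => continuousOn_const
  | n + 1 => h.continuousOn_volterra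
      (((h.continuousOn_jostTerm n).mono Ioi_subset_Ici_self).aestronglyMeasurable
        measurableSet_Ioi) fun _ => h.norm_jostTerm_le_const n

theorem aestronglyMeasurable_jostTerm (h : KernelBound V k q) (n : ℕ) :
    AEStronglyMeasurable (jostTerm V k n) (volume.restrict (Ioi 0)) :=
  ((h.continuousOn_jostTerm n).mono Ioi_subset_Ici_self).aestronglyMeasurable measurableSet_Ioi

theorem hasSum_jostTerm (h : KernelBound V k q) (hx : 0 ≤ x) :
    HasSum (fun n => jostTerm V k n x) (jostFactor V k x) :=
  (Summable.of_norm_bounded (Real.summable_pow_div_factorial (tail q x))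
    fun n => h.norm_jostTerm_le n hx).hasSum

theorem norm_jostFactor_le (h : KernelBound V k q) (hx : 0 ≤ x) :
    ‖jostFactor V k x‖ ≤ Real.exp (tail q x) := by
  rw [Real.exp_eq_exp_ℝ]
  exact tsum_of_norm_bounded (NormedSpace.expSeries_div_hasSum_exp (tail q x))
    fun n => h.norm_jostTerm_le n hx

theorem norm_jostFactor_sub_one_le (h : KernelBound V k q) (hx : 0 ≤ x) :
    ‖jostFactor V k x - 1‖ ≤ Real.exp (tail q x) - 1 := by
  have hterm := (hasSum_nat_add_iff' 1).2 (h.hasSum_jostTerm hx)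
  have hexp := (hasSum_nat_add_iff' 1).2 (NormedSpace.expSeries_div_hasSum_exp (tail q x))
  simp only [Finset.sum_range_one, pow_zero, Nat.factorial_zero, Nat.cast_one, div_one,
    ← Real.exp_eq_exp_ℝ] at hexp
  rw [Finset.sum_range_one, jostTerm, Pi.one_apply] at hterm
  exact hterm.norm_le_of_bounded hexp fun n => h.norm_jostTerm_le (n + 1) hx

theorem norm_jostFactor_le_const (h : KernelBound V k q) (hx : 0 ≤ x) :
    ‖jostFactor V k x‖ ≤ Real.exp (tail q 0) :=
  (h.norm_jostFactor_le hx).trans (Real.exp_le_exp.2 (h.tail_le hx))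

theorem continuousOn_jostFactor (h : KernelBound V k q) :
    ContinuousOn (jostFactor V k) (Ici 0) :=
  continuousOn_tsum h.continuousOn_jostTerm (Real.summable_pow_div_factorial (tail q 0))
    fun n _ hx => h.norm_jostTerm_le_const n hx

theorem aestronglyMeasurable_jostFactor (h : KernelBound V k q) :
    AEStronglyMeasurable (jostFactor V k) (volume.restrict (Ioi 0)) :=
  (h.continuousOn_jostFactor.mono Ioi_subset_Ici_self).aestronglyMeasurable measurableSet_Ioi

theorem jostFactor_eq_one_add_volterra (h : KernelBound V k q) (hx : 0 ≤ x) :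
    jostFactor V k x = 1 + volterra V k (jostFactor V k) x := by
  have hexp := Real.summable_pow_div_factorial (tail q 0)
  have hsum : HasSum (fun n => jostTerm V k (n + 1) x) (volterra V k (jostFactor V k) x) := by
    refine hasSum_integral_of_dominated_convergence
      (fun n t => q t * (tail q 0 ^ n / n.factorial))
      (fun n => h.aestronglyMeasurable x (h.aestronglyMeasurable_jostTerm n)) (fun n => ?_)
      (.of_forall fun t => hexp.mul_left _) ?_ ?_
    · filter_upwards [ae_restrict_mem measurableSet_Ioi] with t ht
      exact h.norm_kernel_mul_le hx (le_of_lt ht) (h.norm_jostTerm_le_const n (le_of_lt ht))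
    · simpa only [tsum_mul_left] using h.integrableOn.mul_const _
    · filter_upwards [ae_restrict_mem measurableSet_Ioi] with t ht
      exact (h.hasSum_jostTerm (le_of_lt ht)).mul_left _
  have hzero := (hasSum_nat_add_iff' 1).2 (h.hasSum_jostTerm hx)
  rw [Finset.sum_range_one, jostTerm, Pi.one_apply] at hzero
  rw [hsum.unique hzero, add_sub_cancel]

theorem tendsto_jostFactor (h : KernelBound V k q) : Tendsto (jostFactor V k) atTop (𝓝 1) := by
  rw [tendsto_iff_norm_sub_tendsto_zero]
  have hexp : Tendsto (fun x => Real.exp (tail q x) - 1) atTop (𝓝 0) := by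
    have htail : Tendsto (tail q) atTop (𝓝 0) := tendsto_integral_Ioi_atTop h.integrableOn
    simpa using htail.rexp.sub_const 1
  refine squeeze_zero' (.of_forall fun _ => norm_nonneg _) ?_ hexp
  filter_upwards [eventually_ge_atTop 0] with x hx using h.norm_jostFactor_sub_one_le hx

end KernelBound

section Analytic

variable {V : ℝ → ℂ} {q : ℝ → ℝ} {U : Set ℂ} {x : ℝ}

theorem differentiableOn_jostTerm (hU : IsOpen U) (h : ∀ k ∈ U, KernelBound V k q) (n : ℕ)
    (hx : 0 ≤ x) : DifferentiableOn ℂ (fun k => jostTerm V k n x) U := by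
  rcases U.eq_empty_or_nonempty with rfl | ⟨k₁, hk₁⟩
  · exact differentiableOn_empty
  induction n generalizing x with
  | zero => exact differentiableOn_const 1
  | succ n ih =>
    refine differentiableOn_integral_of_norm_le hU
      (g := fun t => q t * (tail q 0 ^ n / n.factorial))
      (fun k hk => (h k hk).aestronglyMeasurable x ((h k hk).aestronglyMeasurable_jostTerm n))
      ?_ ?_ ((h k₁ hk₁).integrableOn.mul_const _)
    · filter_upwards [ae_restrict_mem measurableSet_Ioi] with t ht
      exact ((differentiable_volterraKernel _).differentiableOn.mul_const _).mul
        (ih (le_of_lt ht))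
    · filter_upwards [ae_restrict_mem measurableSet_Ioi] with t ht k hk
      exact (h k hk).norm_kernel_mul_le hx (le_of_lt ht)
        ((h k hk).norm_jostTerm_le_const n (le_of_lt ht))

theorem differentiableOn_jostFactor (hU : IsOpen U) (h : ∀ k ∈ U, KernelBound V k q)
    (hx : 0 ≤ x) : DifferentiableOn ℂ (fun k => jostFactor V k x) U :=
  Complex.differentiableOn_tsum_of_summable_norm (Real.summable_pow_div_factorial (tail q 0))
    (fun n => differentiableOn_jostTerm hU h n hx) hU
    fun n k hk => (h k hk).norm_jostTerm_le_const n hx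

end Analytic

/-- `y` solves `-y'' + V y = f` on `[0, ∞)` with derivative `y' = p`; this is `Solves` with the
derivative made explicit. -/
structure SolvesWith (V f y p : ℝ → ℂ) : Prop where
  hasDerivWithinAt : ∀ x, 0 ≤ x → HasDerivWithinAt y (p x) (Ici 0) x
  isPrimitive_deriv : IsPrimitive p fun t => V t * y t - f t

theorem solves_iff_exists_solvesWith {V f y : ℝ → ℂ} : Solves V f y ↔ ∃ p, SolvesWith V f y p :=
  ⟨fun ⟨p, hd, hi, heq⟩ => ⟨p, hd, hi, heq⟩,
    fun ⟨p, hd, hp⟩ => ⟨p, hd, hp.intervalIntegrable_zero, hp.eq_add_integral⟩⟩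

namespace SolvesWith

variable {V f g y z p r : ℝ → ℂ} {x : ℝ} {c κ : ℂ}

theorem hasDerivAt (h : SolvesWith V f y p) (hx : 0 < x) : HasDerivAt y (p x) x :=
  (h.hasDerivWithinAt x hx.le).hasDerivAt (Ici_mem_nhds hx)

theorem isPrimitive (h : SolvesWith V f y p) : IsPrimitive y p :=
  .of_hasDerivWithinAt h.hasDerivWithinAt h.isPrimitive_deriv.continuousOn

theorem continuousOn (h : SolvesWith V f y p) : ContinuousOn y (Ici 0) :=
  h.isPrimitive.continuousOn

theorem sub (h : SolvesWith V f y p) (h' : SolvesWith V g z r) :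
    SolvesWith V (fun x => f x - g x) (fun x => y x - z x) (fun x => p x - r x) :=
  ⟨fun x hx => (h.hasDerivWithinAt x hx).sub (h'.hasDerivWithinAt x hx),
    (h.isPrimitive_deriv.sub h'.isPrimitive_deriv).congr fun x _ => by ring⟩

theorem const_mul (h : SolvesWith V f y p) (c : ℂ) :
    SolvesWith V (fun x => c * f x) (fun x => c * y x) (fun x => c * p x) :=
  ⟨fun x hx => (h.hasDerivWithinAt x hx).const_mul c,
    (h.isPrimitive_deriv.const_mul c).congr fun x _ => by ring⟩

theorem congr_ae (h : SolvesWith V f y p) (hfg : f =ᵐ[volume.restrict (Ioi (0 : ℝ))] g) :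
    SolvesWith V g y p :=
  ⟨h.hasDerivWithinAt, h.isPrimitive_deriv.congr_ae (hfg.mono fun x hx => by simp only [hx])⟩

theorem isPrimitive_wronskian (h : SolvesWith V f y p) (h' : SolvesWith V g z r) :
    IsPrimitive (fun x => y x * r x - p x * z x) (fun x => f x * z x - y x * g x) :=
  ((h.isPrimitive.mul h'.isPrimitive_deriv).sub
    (h.isPrimitive_deriv.mul h'.isPrimitive)).congr fun x _ => by ring

theorem wronskian_eq (h : SolvesWith V (fun x => κ * y x) y p)
    (h' : SolvesWith V (fun x => κ * z x) z r) (hx : 0 ≤ x) :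
    y x * r x - p x * z x = y 0 * r 0 - p 0 * z 0 := by
  have hW := (h.isPrimitive_wronskian h').congr (w := 0) fun t _ => by
    simp only [Pi.zero_apply]
    ring
  simpa using hW.eq_add_integral x hx

theorem norm_add_norm_le_integral (hV : ∀ x, 0 ≤ x → IntervalIntegrable V volume 0 x)
    (h : SolvesWith V (fun x => κ * y x) y p) (hy : y 0 = 0) (hp : p 0 = 0) (hx : 0 ≤ x) :
    ‖y x‖ + ‖p x‖ ≤ ∫ t in (0 : ℝ)..x, (1 + ‖V t‖ + ‖κ‖) * (‖y t‖ + ‖p t‖) := by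
  have hs : uIcc 0 x ⊆ Ici 0 := by
    rw [uIcc_of_le hx]
    exact Icc_subset_Ici_self
  have hpc := (h.isPrimitive_deriv.continuousOn.mono hs).norm
  have hpi := (h.isPrimitive_deriv.intervalIntegrable_zero x hx).norm
  have hq : IntervalIntegrable (fun t => 1 + ‖V t‖ + ‖κ‖) volume 0 x :=
    (intervalIntegrable_const.add (hV x hx).norm).add intervalIntegrable_const
  calc ‖y x‖ + ‖p x‖
      = ‖∫ t in (0 : ℝ)..x, p t‖ + ‖∫ t in (0 : ℝ)..x, (V t * y t - κ * y t)‖ := by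
        rw [h.isPrimitive.eq_add_integral x hx, h.isPrimitive_deriv.eq_add_integral x hx, hy, hp,
          zero_add, zero_add]
    _ ≤ (∫ t in (0 : ℝ)..x, ‖p t‖) + ∫ t in (0 : ℝ)..x, ‖V t * y t - κ * y t‖ :=
        add_le_add (intervalIntegral.norm_integral_le_integral_norm hx)
          (intervalIntegral.norm_integral_le_integral_norm hx)
    _ = ∫ t in (0 : ℝ)..x, (‖p t‖ + ‖V t * y t - κ * y t‖) :=
        (intervalIntegral.integral_add hpc.intervalIntegrable hpi).symm
    _ ≤ _ := by
        refine intervalIntegral.integral_mono_on hx (hpc.intervalIntegrable.add hpi)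
          (hq.mul_continuousOn ((h.continuousOn.mono hs).norm.add hpc)) fun t _ => ?_
        have hsub : ‖V t * y t - κ * y t‖ ≤ (‖V t‖ + ‖κ‖) * ‖y t‖ := by
          rw [add_mul, ← norm_mul, ← norm_mul]
          exact norm_sub_le _ _
        nlinarith [norm_nonneg (y t), mul_nonneg (add_nonneg (norm_nonneg (V t)) (norm_nonneg κ))
          (norm_nonneg (p t))]

theorem eq_zero (hV : ∀ x, 0 ≤ x → IntervalIntegrable V volume 0 x)
    (h : SolvesWith V (fun x => κ * y x) y p) (hy : y 0 = 0) (hp : p 0 = 0) (hx : 0 ≤ x) :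
    y x = 0 := by
  have hsum : ‖y x‖ + ‖p x‖ = 0 :=
    eq_zero_of_le_integral (q := fun t => 1 + ‖V t‖ + ‖κ‖) (N := fun t => ‖y t‖ + ‖p t‖)
      (fun x hx => (intervalIntegrable_const.add (hV x hx).norm).add intervalIntegrable_const)
      (fun t => by positivity) (h.continuousOn.norm.add h.isPrimitive_deriv.continuousOn.norm)
      (fun t _ => by positivity) (fun t ht => h.norm_add_norm_le_integral hV hy hp ht) hx
  exact norm_eq_zero.1 ((add_eq_zero_iff_of_nonneg (norm_nonneg _) (norm_nonneg _)).1 hsum).1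

theorem eq_const_mul (hV : ∀ x, 0 ≤ x → IntervalIntegrable V volume 0 x)
    (h : SolvesWith V (fun x => κ * y x) y p) (h' : SolvesWith V (fun x => κ * z x) z r)
    (hz : z 0 = c * y 0) (hr : r 0 = c * p 0) (hx : 0 ≤ x) : z x = c * y x := by
  have hsub : SolvesWith V (fun x => κ * (z x - c * y x)) (fun x => z x - c * y x)
      (fun x => r x - c * p x) :=
    (h'.sub (h.const_mul c)).congr_ae (.of_forall fun x => by ring)
  exact sub_eq_zero.1 (hsub.eq_zero hV (sub_eq_zero.2 hz) (sub_eq_zero.2 hr) hx)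

theorem exists_eq_const_mul_of_wronskian_eq_zero
    (hV : ∀ x, 0 ≤ x → IntervalIntegrable V volume 0 x)
    (h : SolvesWith V (fun x => κ * y x) y p) (h' : SolvesWith V (fun x => κ * z x) z r)
    (hne : ∃ x, 0 ≤ x ∧ y x ≠ 0) (hW : y 0 * r 0 - p 0 * z 0 = 0) :
    ∃ c, ∀ x, 0 ≤ x → z x = c * y x := by
  by_cases hy : y 0 = 0
  · have hp : p 0 ≠ 0 := fun hp => by
      obtain ⟨x, hx, hyx⟩ := hne
      exact hyx (h.eq_zero hV hy hp hx)
    have hz : z 0 = 0 := by simpa [hy, hp] using hW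
    exact ⟨r 0 / p 0, fun x hx => h.eq_const_mul hV h' (by rw [hy, hz, mul_zero])
      (div_mul_cancel₀ _ hp).symm hx⟩
  · refine ⟨z 0 / y 0, fun x hx => h.eq_const_mul hV h' (div_mul_cancel₀ _ hy).symm ?_ hx⟩
    field_simp
    linear_combination hW

end SolvesWith

section WronskianLimit

variable {k L : ℂ} {e p u r v φ : ℝ → ℂ} {h : ℝ}

theorem exists_volterraKernel_ne_zero (k : ℂ) : ∃ h : ℝ, 0 < h ∧ volterraKernel k h ≠ 0 := by
  have hne : ∀ᶠ s in 𝓝[≠] (0 : ℝ), volterraKernel k s ≠ 0 :=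
    (hasDerivAt_volterraKernel k 0).eventually_ne (by simp)
  have hpos : ∀ᶠ s in 𝓝[>] (0 : ℝ), 0 < s := self_mem_nhdsWithin
  exact (hpos.and (hne.filter_mono (nhdsWithin_mono _ fun s hs => ne_of_gt hs))).exists

theorem tendsto_cexp_mul_sub (hk : 0 ≤ k.im)
    (hv : ∀ᶠ t : ℝ in atTop, HasDerivAt v (φ t * Complex.exp (-(2 * Complex.I * k * t))) t)
    (hφ : Tendsto φ atTop (𝓝 L)) (hh : 0 ≤ h) :
    Tendsto (fun x : ℝ => Complex.exp (2 * Complex.I * k * x) * (v (x + h) - v x)) atTop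
      (𝓝 (L * volterraKernel (-k) h)) := by
  set C := Real.exp (2 * k.im * h) * h
  have : 0 ≤ C := by positivity
  refine Metric.tendsto_nhds.2 fun ε hε => ?_
  obtain ⟨X, hX⟩ := eventually_atTop.1
    (hv.and (Metric.tendsto_nhds.1 hφ (ε / (C + 1)) (by positivity)))
  filter_upwards [eventually_ge_atTop X] with x hx
  have hderiv (s : ℝ) (hs : s ∈ Icc 0 h) : HasDerivWithinAt
      (fun s : ℝ => Complex.exp (2 * Complex.I * k * x) * v (x + s) - L * volterraKernel (-k) s)
      ((φ (x + s) - L) * Complex.exp (2 * Complex.I * (-k) * s)) (Icc 0 h) s := by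
    have hxs := (hX (x + s) (by linarith [hs.1])).1.comp_const_add x s
    refine ((hxs.const_mul _).sub
      ((hasDerivAt_volterraKernel (-k) s).const_mul L)).hasDerivWithinAt.congr_deriv ?_
    rw [sub_mul, mul_left_comm, ← Complex.exp_add]
    congr 3
    push_cast
    ring
  have hbound (s : ℝ) (hs : s ∈ Icc 0 h) :
      ‖(φ (x + s) - L) * Complex.exp (2 * Complex.I * (-k) * s)‖ ≤
        ε / (C + 1) * Real.exp (2 * k.im * h) := by
    rw [norm_mul, ← dist_eq_norm]
    have hexp := norm_cexp_two_I_mul_le (k := -k) (a := 2 * k.im) (by simp) hs.1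
    refine mul_le_mul (hX _ (by linarith [hs.1])).2.le (hexp.trans ?_) (norm_nonneg _)
      (by positivity)
    gcongr
    exact hs.2
  have hmean := (convex_Icc 0 h).norm_image_sub_le_of_norm_hasDerivWithin_le hderiv hbound
    (left_mem_Icc.2 hh) (right_mem_Icc.2 hh)
  rw [add_zero, volterraKernel_zero_right, mul_zero, sub_zero, sub_zero, sub_right_comm,
    ← mul_sub, Real.norm_of_nonneg hh, mul_assoc (ε / (C + 1))] at hmean
  calc dist _ _ ≤ ε / (C + 1) * C := by rwa [dist_eq_norm]
    _ < ε := by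
      rw [div_mul_eq_mul_div, div_lt_iff₀ (by positivity)]
      linarith

theorem tendsto_cexp_mul_div (hk : 0 ≤ k.im)
    (he : Tendsto (fun x : ℝ => e x * Complex.exp (-(Complex.I * k * x))) atTop (𝓝 1))
    {l : Filter ℝ} (hl : l ≤ atTop) (hu : Tendsto (fun x => u (x + h)) l (𝓝 0)) :
    Tendsto (fun x : ℝ => Complex.exp (2 * Complex.I * k * x) * (u (x + h) / e (x + h))) l
      (𝓝 0) := by
  have hm := (he.comp (tendsto_atTop_add_const_right atTop h tendsto_id)).mono_left hl
  have hquot := (hu.norm.div hm.norm (by simp))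
  rw [norm_zero, zero_div] at hquot
  refine squeeze_zero_norm' ?_ hquot
  filter_upwards [hl (eventually_ge_atTop h)] with x hx
  simp only [Pi.div_apply, Function.comp_apply, id, norm_mul, norm_div, Complex.norm_exp]
  have hexp : Real.exp (2 * Complex.I * k * x).re ≤
      (Real.exp (-(Complex.I * k * ((x + h : ℝ) : ℂ))).re)⁻¹ := by
    rw [← Real.exp_neg]
    gcongr
    simp only [Complex.mul_re, Complex.mul_im, Complex.neg_re, Complex.I_re, Complex.I_im,
      Complex.ofReal_re, Complex.ofReal_im, Complex.re_ofNat, Complex.im_ofNat]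
    nlinarith [mul_nonneg hk (sub_nonneg.2 hx)]
  calc _ ≤ (Real.exp (-(Complex.I * k * ((x + h : ℝ) : ℂ))).re)⁻¹ * (‖u (x + h)‖ / ‖e (x + h)‖) :=
        by gcongr
    _ = _ := by field

-- Since `(u / e)'` is the Wronskian divided by `e²`, it is asymptotic to `L e^{-2ikx}`, so over a
-- window `[x, x + h]` the quotient `u / e` moves by about `L D(h) e^{-2ikx}` with `D(h) ≠ 0`. Where
-- `u x` and `u (x + h)` are both small, this forces `L = 0`.
theorem eq_zero_of_tendsto_wronskian (hk : 0 ≤ k.im) (he : ∀ᶠ x in atTop, HasDerivAt e (p x) x)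
    (hasy : Tendsto (fun x : ℝ => e x * Complex.exp (-(Complex.I * k * x))) atTop (𝓝 1))
    (hu : ∀ᶠ x in atTop, HasDerivAt u (r x) x)
    (hW : Tendsto (fun x => e x * r x - p x * u x) atTop (𝓝 L))
    (hsmall : ∀ h > 0, MapClusterPt (0 : ℂ × ℂ) atTop fun x => (u x, u (x + h))) : L = 0 := by
  obtain ⟨h, hh, hD⟩ := exists_volterraKernel_ne_zero (-k)
  have hφ : Tendsto (fun x : ℝ => (e x * r x - p x * u x) /
      (e x * Complex.exp (-(Complex.I * k * x))) ^ 2) atTop (𝓝 L) := by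
    simpa only [one_pow, div_one] using! hW.div (hasy.pow 2) (by simp)
  have hv : ∀ᶠ x : ℝ in atTop, HasDerivAt (fun x => u x / e x)
      ((e x * r x - p x * u x) / (e x * Complex.exp (-(Complex.I * k * x))) ^ 2 *
        Complex.exp (-(2 * Complex.I * k * x))) x := by
    filter_upwards [he, hu, hasy.eventually_ne one_ne_zero] with x hex hux hne
    refine (hux.div hex (left_ne_zero_of_mul hne)).congr_deriv ?_
    have hexp : Complex.exp (-(2 * Complex.I * k * x)) =
        Complex.exp (-(Complex.I * k * x)) ^ 2 := by
      rw [← Complex.exp_nat_mul]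
      congr 1
      push_cast
      ring
    rw [hexp]
    field [left_ne_zero_of_mul hne, right_ne_zero_of_mul hne]
  obtain ⟨l, hl, hlim⟩ := mapClusterPt_iff_ultrafilter.1 (hsmall h hh)
  rw [← Prod.mk_zero_zero, nhds_prod_eq, tendsto_prod_iff'] at hlim
  have hu0 : Tendsto (fun x => u (x + 0)) l (𝓝 0) := by simpa only [add_zero] using hlim.1
  have hzero := (tendsto_cexp_mul_div hk hasy hl hlim.2).sub (tendsto_cexp_mul_div hk hasy hl hu0)
  simp only [add_zero, ← mul_sub, sub_zero] at hzero
  have hLD := tendsto_nhds_unique ((tendsto_cexp_mul_sub hk hv hφ hh.le).mono_left hl) hzero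
  exact (mul_eq_zero.1 hLD).resolve_right hD

theorem SolvesWith.exists_eq_const_mul {V : ℝ → ℂ}
    (hV : ∀ x, 0 ≤ x → IntervalIntegrable V volume 0 x) (hk : 0 ≤ k.im)
    (he : SolvesWith V (fun x => k ^ 2 * e x) e p)
    (hasy : Tendsto (fun x : ℝ => e x * Complex.exp (-(Complex.I * k * x))) atTop (𝓝 1))
    (hu : SolvesWith V (fun x => k ^ 2 * u x) u r)
    (hsmall : ∀ h > 0, MapClusterPt (0 : ℂ × ℂ) atTop fun x => (u x, u (x + h))) :
    ∃ c, ∀ x, 0 ≤ x → u x = c * e x := by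
  have hne : ∃ x, 0 ≤ x ∧ e x ≠ 0 :=
    ((eventually_ge_atTop 0).and ((hasy.eventually_ne one_ne_zero).mono
      fun x hx => left_ne_zero_of_mul hx)).exists
  have hW : Tendsto (fun x => e x * r x - p x * u x) atTop (𝓝 (e 0 * r 0 - p 0 * u 0)) :=
    tendsto_const_nhds.congr'
      ((eventually_ge_atTop 0).mono fun x hx => (he.wronskian_eq hu hx).symm)
  exact he.exists_eq_const_mul_of_wronskian_eq_zero hV hu hne <| eq_zero_of_tendsto_wronskian hk
    ((eventually_gt_atTop 0).mono fun x hx => he.hasDerivAt hx) hasy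
    ((eventually_gt_atTop 0).mono fun x hx => hu.hasDerivAt hx) hW hsmall

theorem IsJostSolution.eqOn {V y z : ℝ → ℂ}
    (hV : ∀ x, 0 ≤ x → IntervalIntegrable V volume 0 x) (hk : 0 ≤ k.im)
    (hy : IsJostSolution V k y) (hz : IsJostSolution V k z) : EqOn y z (Ici 0) := by
  obtain ⟨p, hp⟩ := solves_iff_exists_solvesWith.1 hy.1
  obtain ⟨r, hr⟩ := solves_iff_exists_solvesWith.1 hz.1
  have hd : SolvesWith V (fun x => k ^ 2 * (y x - z x)) (fun x => y x - z x)
      (fun x => p x - r x) :=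
    (hp.sub hr).congr_ae (.of_forall fun x => by ring)
  have hlim : Tendsto (fun x : ℝ => (y x - z x) * Complex.exp (-(Complex.I * k * x))) atTop
      (𝓝 0) := by
    simpa only [sub_mul, sub_self] using hy.2.sub hz.2
  have hzero : Tendsto (fun x => y x - z x) atTop (𝓝 0) := by
    refine squeeze_zero_norm' ?_ (tendsto_zero_iff_norm_tendsto_zero.1 hlim)
    filter_upwards [eventually_ge_atTop 0] with x hx
    rw [norm_mul, Complex.norm_exp]
    refine le_mul_of_one_le_right (norm_nonneg _) (Real.one_le_exp ?_)
    simpa using mul_nonneg hk hx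
  obtain ⟨c, hc⟩ := hr.exists_eq_const_mul hV hk hz.2 hd fun h _ =>
    (hzero.prodMk_nhds
      (hzero.comp (tendsto_atTop_add_const_right _ h tendsto_id))).mapClusterPt
  have hc0 : c = 0 := by
    refine tendsto_nhds_unique ?_ hlim
    refine ((hz.2.const_mul c).congr' ?_).trans_eq (by rw [mul_one])
    filter_upwards [eventually_ge_atTop 0] with x hx
    rw [hc x hx, mul_assoc c]
  intro x hx
  exact sub_eq_zero.1 ((hc x hx).trans (by rw [hc0, zero_mul]))

end WronskianLimit

theorem hasDerivAt_volterraKernel_max_sub (k : ℂ) {t x : ℝ} (htx : t ≠ x) :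
    HasDerivAt (fun y => volterraKernel k (max (t - y) 0))
      ((Ioi x).indicator (fun s : ℝ =>
        -(Complex.exp (-(2 * Complex.I * k * x)) * Complex.exp (2 * Complex.I * k * s))) t) x := by
  rcases htx.lt_or_gt with h | h
  · rw [indicator_of_notMem (notMem_Ioi.2 h.le)]
    refine (hasDerivAt_const x 0).congr_of_eventuallyEq ?_
    filter_upwards [lt_mem_nhds h] with y hy
    rw [max_eq_right (sub_nonpos.2 hy.le), volterraKernel_zero_right]
  · rw [indicator_of_mem (mem_Ioi.2 h), ← Complex.exp_add]
    have hd := (hasDerivAt_volterraKernel k (t - x)).scomp x ((hasDerivAt_id x).const_sub t)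
    refine (hd.congr_of_eventuallyEq ?_).congr_deriv ?_
    · filter_upwards [gt_mem_nhds h] with y hy
      simp only [Function.comp_apply, max_eq_left (sub_nonneg.2 (le_of_lt hy))]
    · rw [neg_one_smul]
      congr 2
      push_cast
      ring

theorem lipschitzOnWith_volterraKernel {k : ℂ} (hk : 0 ≤ k.im) :
    LipschitzOnWith 1 (volterraKernel k) (Ici 0) := by
  refine (convex_Ici 0).lipschitzOnWith_of_nnnorm_hasDerivWithin_le
    (fun u _ => (hasDerivAt_volterraKernel k u).hasDerivWithinAt) fun u hu => ?_
  rw [← NNReal.coe_le_coe, coe_nnnorm]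
  simpa using norm_cexp_two_I_mul_le (a := 0) (by simpa using hk) hu

theorem lipschitzWith_volterraKernel_max_sub {k : ℂ} (hk : 0 ≤ k.im) (t : ℝ) :
    LipschitzWith 1 fun y => volterraKernel k (max (t - y) 0) := by
  refine LipschitzWith.of_dist_le_mul fun y z => ?_
  have hK := (lipschitzOnWith_volterraKernel hk).dist_le_mul _
    (mem_Ici.2 (le_max_right (t - y) 0)) _ (mem_Ici.2 (le_max_right (t - z) 0))
  have hmax : dist (max (t - y) 0) (max (t - z) 0) ≤ dist y z := by
    simpa only [Real.dist_eq, sub_sub_sub_cancel_left, abs_sub_comm z y] using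
      abs_max_sub_max_le_abs (t - y) (t - z) 0
  exact hK.trans (mul_le_mul_of_nonneg_left hmax NNReal.zero_le_coe)

theorem hasDerivAt_volterra {V f : ℝ → ℂ} {k : ℂ} {x : ℝ} (hk : 0 ≤ k.im) (hx : 0 ≤ x)
    (hVf : IntegrableOn (fun t => V t * f t) (Ioi 0))
    (hint : IntegrableOn (fun t => volterraKernel k (max (t - x) 0) * V t * f t) (Ioi 0)) :
    HasDerivAt (volterra V k f) (-(Complex.exp (-(2 * Complex.I * k * x)) *
      ∫ t in Ioi x, Complex.exp (2 * Complex.I * k * t) * (V t * f t))) x := by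
  set F' : ℝ → ℂ := fun t => (Ioi x).indicator
    (fun s : ℝ =>
      -(Complex.exp (-(2 * Complex.I * k * x)) * Complex.exp (2 * Complex.I * k * s))) t *
        (V t * f t)
  have hF' : ∫ t in Ioi 0, F' t = -(Complex.exp (-(2 * Complex.I * k * x)) *
      ∫ t in Ioi x, Complex.exp (2 * Complex.I * k * t) * (V t * f t)) := by
    have hind : F' = (Ioi x).indicator fun t : ℝ => -(Complex.exp (-(2 * Complex.I * k * x)) *
        Complex.exp (2 * Complex.I * k * t)) * (V t * f t) := by
      funext t
      simp only [F', indicator_apply, ite_mul, zero_mul]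
    rw [hind, setIntegral_indicator measurableSet_Ioi, inter_eq_right.2 (Ioi_subset_Ioi hx),
      ← integral_const_mul, ← integral_neg]
    simp only [neg_mul, mul_assoc]
  simp only [mul_assoc (volterraKernel _ _)] at hint
  have hmeas (y : ℝ) : AEStronglyMeasurable
      (fun t => volterraKernel k (max (t - y) 0) * (V t * f t)) (volume.restrict (Ioi 0)) :=
    ((continuous_volterraKernel k).comp (by fun_prop)).aestronglyMeasurable.mul
      hVf.aestronglyMeasurable
  have hmeas' : AEStronglyMeasurable F' (volume.restrict (Ioi 0)) :=
    ((Continuous.aestronglyMeasurable (by fun_prop)).indicator measurableSet_Ioi).mul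
      hVf.aestronglyMeasurable
  have hlip (t : ℝ) : LipschitzOnWith (Real.nnabs ‖V t * f t‖)
      (fun y => volterraKernel k (max (t - y) 0) * (V t * f t)) univ := by
    refine LipschitzOnWith.of_dist_le_mul fun y _ z _ => ?_
    have hK := (lipschitzWith_volterraKernel_max_sub hk t).dist_le_mul y z
    rw [NNReal.coe_one, one_mul] at hK
    rw [dist_eq_norm, ← sub_mul, norm_mul, mul_comm, ← dist_eq_norm, Real.coe_nnabs, abs_norm]
    exact mul_le_mul_of_nonneg_left hK (norm_nonneg _)
  have hderiv : ∀ᵐ t ∂volume.restrict (Ioi (0 : ℝ)),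
      HasDerivAt (fun y => volterraKernel k (max (t - y) 0) * (V t * f t)) (F' t) x := by
    filter_upwards [ae_restrict_of_ae (Measure.ae_ne volume x)] with t ht
    exact (hasDerivAt_volterraKernel_max_sub k ht).mul_const _
  have hmain := (hasDerivAt_integral_of_dominated_loc_of_lip univ_mem (.of_forall hmeas) hint
    hmeas' (.of_forall hlip) hVf.norm hderiv).2
  have hvolterra : volterra V k f =
      fun y => ∫ t in Ioi 0, volterraKernel k (max (t - y) 0) * (V t * f t) := by
    funext y
    simp only [volterra, mul_assoc]
  rwa [hvolterra, ← hF']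

theorem aestronglyMeasurable_of_smul {α E : Type*} [MeasurableSpace α] {μ : Measure α}
    [NormedAddCommGroup E] [NormedSpace ℝ E] {w : α → ℝ} {f : α → E}
    (hw : AEStronglyMeasurable w μ) (hw0 : ∀ᵐ x ∂μ, w x ≠ 0)
    (h : AEStronglyMeasurable (fun x => w x • f x) μ) : AEStronglyMeasurable f μ := by
  refine (hw.aemeasurable.inv.aestronglyMeasurable.smul h).congr ?_
  filter_upwards [hw0] with x hx
  exact inv_smul_smul₀ hx (f x)

theorem integrable_mul_norm_of_norm_le {α E : Type*} [MeasurableSpace α] {μ : Measure α}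
    [NormedAddCommGroup E] [NormedSpace ℝ E] {w g : α → ℝ} {f : α → E} {C : ℝ}
    (h : Integrable (fun x => w x • f x) μ) (hf : AEStronglyMeasurable f μ)
    (hg : AEStronglyMeasurable g μ) (hgw : ∀ᵐ x ∂μ, ‖g x‖ ≤ C * ‖w x‖) :
    Integrable (fun x => g x * ‖f x‖) μ := by
  refine (h.norm.const_mul C).mono' (hg.mul hf.norm) ?_
  filter_upwards [hgw] with x hx
  rw [norm_mul, norm_norm, norm_smul, ← mul_assoc]
  exact mul_le_mul_of_nonneg_right hx (norm_nonneg _)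

/-- The integrability condition `∫₀^∞ (1 + x) |V(x)| dx < ∞`, under which the Jost solutions exist
for all `k` in the closed upper half-plane. -/
def MarchenkoClass (V : ℝ → ℂ) : Prop :=
  IntegrableOn (fun x => (1 + x) • V x) (Ioi 0)

namespace MarchenkoClass

variable {V : ℝ → ℂ} {k : ℂ} {x : ℝ}

theorem aestronglyMeasurable (hV : MarchenkoClass V) :
    AEStronglyMeasurable V (volume.restrict (Ioi 0)) := by
  refine aestronglyMeasurable_of_smul (w := fun x => 1 + x)
    (Continuous.aestronglyMeasurable (by fun_prop)) ?_ (Integrable.aestronglyMeasurable hV)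
  filter_upwards [ae_restrict_mem measurableSet_Ioi] with x hx
  exact (add_pos one_pos hx).ne'

theorem integrableOn_mul_norm (hV : MarchenkoClass V) {g : ℝ → ℝ} {C : ℝ}
    (hg : AEStronglyMeasurable g (volume.restrict (Ioi 0)))
    (hC : ∀ t, 0 < t → ‖g t‖ ≤ C * (1 + t)) : IntegrableOn (fun t => g t * ‖V t‖) (Ioi 0) := by
  refine integrable_mul_norm_of_norm_le (C := C) hV hV.aestronglyMeasurable hg ?_
  filter_upwards [ae_restrict_mem measurableSet_Ioi] with t ht
  rw [Real.norm_of_nonneg (add_pos one_pos ht).le]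
  exact hC t ht

theorem integrableOn (hV : MarchenkoClass V) : IntegrableOn V (Ioi 0) := by
  refine (integrable_norm_iff hV.aestronglyMeasurable).1 ?_
  have h := hV.integrableOn_mul_norm (g := fun _ => 1) (C := 1) aestronglyMeasurable_const
    fun t ht => by simpa using ht.le
  simpa only [one_mul] using! h

theorem intervalIntegrable (hV : MarchenkoClass V) (x : ℝ) (hx : 0 ≤ x) :
    IntervalIntegrable V volume 0 x :=
  (intervalIntegrable_iff_integrableOn_Ioc_of_le hx).2
    (hV.integrableOn.mono_set Ioc_subset_Ioi_self)

theorem kernelBound (hV : MarchenkoClass V) (hk : 0 ≤ k.im) :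
    KernelBound V k fun t => t * ‖V t‖ where
  integrableOn := hV.integrableOn_mul_norm (C := 1) (by fun_prop) fun t ht => by
    rw [Real.norm_of_nonneg ht.le]
    linarith
  aestronglyMeasurable_potential := hV.aestronglyMeasurable
  norm_le s t hs hst := by
    have h := norm_volterraKernel_le_mul_exp le_rfl (by simpa using hk) hs
    rw [zero_mul, Real.exp_zero, mul_one] at h
    exact mul_le_mul_of_nonneg_right (h.trans hst) (norm_nonneg _)

theorem integrableOn_mul_jostFactor (hV : MarchenkoClass V) (hk : 0 ≤ k.im) :
    IntegrableOn (fun t => V t * jostFactor V k t) (Ioi 0) :=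
  hV.integrableOn.mul_bdd (hV.kernelBound hk).aestronglyMeasurable_jostFactor
    ((ae_restrict_mem measurableSet_Ioi).mono fun _ ht =>
      (hV.kernelBound hk).norm_jostFactor_le_const (le_of_lt ht))

theorem integrableOn_cexp_mul_jostFactor (hV : MarchenkoClass V) (hk : 0 ≤ k.im) :
    IntegrableOn (fun t : ℝ => Complex.exp (2 * Complex.I * k * t) * (V t * jostFactor V k t))
      (Ioi 0) := by
  refine (hV.integrableOn_mul_jostFactor hk).bdd_mul (c := 1)
    (Continuous.aestronglyMeasurable (by fun_prop)) ?_
  filter_upwards [ae_restrict_mem measurableSet_Ioi] with t ht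
  simpa using norm_cexp_two_I_mul_le (a := 0) (by simpa using hk) (le_of_lt ht)

end MarchenkoClass

/-- The Jost solution `e(x, k) = e^{ikx} m(x, k)` given by the Neumann series. -/
def jostSol (V : ℝ → ℂ) (k : ℂ) (x : ℝ) : ℂ :=
  Complex.exp (Complex.I * k * x) * jostFactor V k x

/-- The integral `∫ₓ^∞ e^{2ikt} V(t) m(t, k) dt`, which equals `-e^{2ikx} m'(x, k)`. -/
def jostTail (V : ℝ → ℂ) (k : ℂ) (x : ℝ) : ℂ :=
  ∫ t in Ioi x, Complex.exp (2 * Complex.I * k * t) * (V t * jostFactor V k t)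

/-- The derivative `e'(x, k)` of the Jost solution `jostSol`, in terms of `jostTail`. -/
def jostSolDeriv (V : ℝ → ℂ) (k : ℂ) (x : ℝ) : ℂ :=
  Complex.I * k * jostSol V k x - Complex.exp (-(Complex.I * k * x)) * jostTail V k x

theorem hasDerivAt_cexp_mul (c : ℂ) (x : ℝ) :
    HasDerivAt (fun x : ℝ => Complex.exp (c * x)) (c * Complex.exp (c * x)) x := by
  have hlin : HasDerivAt (fun s : ℝ => c * (s : ℂ)) c x := by
    simpa using (hasDerivAt_id x).ofReal_comp.const_mul c
  simpa only [mul_comm] using hlin.cexp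

theorem isPrimitive_cexp_mul (c : ℂ) :
    IsPrimitive (fun x : ℝ => Complex.exp (c * x)) fun x => c * Complex.exp (c * x) :=
  .of_hasDerivWithinAt (fun x _ => (hasDerivAt_cexp_mul c x).hasDerivWithinAt)
    (Continuous.continuousOn (by fun_prop))

@[simp]
theorem jostSol_zero_right (V : ℝ → ℂ) (k : ℂ) : jostSol V k 0 = jostFactor V k 0 := by
  simp [jostSol]

namespace MarchenkoClass

variable {V : ℝ → ℂ} {k : ℂ} {x : ℝ}

theorem hasDerivWithinAt_jostFactor (hV : MarchenkoClass V) (hk : 0 ≤ k.im) (hx : 0 ≤ x) :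
    HasDerivWithinAt (jostFactor V k)
      (-(Complex.exp (-(2 * Complex.I * k * x)) * jostTail V k x)) (Ici 0) x := by
  have hB := hV.kernelBound hk
  have hint : IntegrableOn
      (fun t => volterraKernel k (max (t - x) 0) * V t * jostFactor V k t) (Ioi 0) := by
    refine (hB.integrableOn.mul_const (Real.exp (tail (fun t => t * ‖V t‖) 0))).mono'
      (hB.aestronglyMeasurable x hB.aestronglyMeasurable_jostFactor) ?_
    filter_upwards [ae_restrict_mem measurableSet_Ioi] with t ht
    exact hB.norm_kernel_mul_le hx (le_of_lt ht) (hB.norm_jostFactor_le_const (le_of_lt ht))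
  exact ((hasDerivAt_volterra hk hx (hV.integrableOn_mul_jostFactor hk) hint).const_add
    1).hasDerivWithinAt.congr (fun y hy => hB.jostFactor_eq_one_add_volterra hy)
    (hB.jostFactor_eq_one_add_volterra hx)

theorem hasDerivWithinAt_jostSol (hV : MarchenkoClass V) (hk : 0 ≤ k.im) (hx : 0 ≤ x) :
    HasDerivWithinAt (jostSol V k) (jostSolDeriv V k x) (Ici 0) x := by
  refine ((hasDerivAt_cexp_mul (Complex.I * k) x).hasDerivWithinAt.mul
    (hV.hasDerivWithinAt_jostFactor hk hx)).congr_deriv ?_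
  have hexp : Complex.exp (-(Complex.I * k * x)) =
      Complex.exp (Complex.I * k * x) * Complex.exp (-(2 * Complex.I * k * x)) := by
    rw [← Complex.exp_add]
    congr 1
    ring
  rw [jostSolDeriv, jostSol, hexp]
  ring

theorem solvesWith_jostSol (hV : MarchenkoClass V) (hk : 0 ≤ k.im) :
    SolvesWith V (fun x => k ^ 2 * jostSol V k x) (jostSol V k) (jostSolDeriv V k) := by
  have hd (x : ℝ) (hx : 0 ≤ x) := hV.hasDerivWithinAt_jostSol hk hx
  have hET := (isPrimitive_cexp_mul (-(Complex.I * k))).mul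
    (isPrimitive_integral_Ioi (hV.integrableOn_cexp_mul_jostFactor hk))
  simp only [neg_mul] at hET
  have hJ : IsPrimitive (jostSol V k) (jostSolDeriv V k) := by
    refine .of_hasDerivWithinAt hd (ContinuousOn.sub ?_ hET.continuousOn)
    exact ContinuousOn.const_smul (fun x hx => (hd x hx).continuousWithinAt) (Complex.I * k)
  refine ⟨hd, ((hJ.const_mul (Complex.I * k)).sub hET).congr fun x _ => ?_⟩
  have hexp : Complex.exp (-(Complex.I * k * x)) * Complex.exp (2 * Complex.I * k * x) =
      Complex.exp (Complex.I * k * x) := by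
    rw [← Complex.exp_add]
    congr 1
    ring
  simp only [jostSolDeriv, jostSol, jostTail]
  linear_combination (V x * jostFactor V k x) * hexp +
    k ^ 2 * Complex.exp (Complex.I * k * x) * jostFactor V k x * Complex.I_mul_I

theorem isJostSolution_jostSol (hV : MarchenkoClass V) (hk : 0 ≤ k.im) :
    IsJostSolution V k (jostSol V k) := by
  refine ⟨solves_iff_exists_solvesWith.2 ⟨_, hV.solvesWith_jostSol hk⟩,
    (hV.kernelBound hk).tendsto_jostFactor.congr fun x => ?_⟩
  rw [jostSol, mul_right_comm, ← Complex.exp_add, add_neg_cancel, Complex.exp_zero, one_mul]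

theorem jost_eq_jostFactor (hV : MarchenkoClass V) (hk : 0 ≤ k.im) :
    jost V k = jostFactor V k 0 := by
  have hJ := hV.isJostSolution_jostSol hk
  have h0 := (Classical.epsilon_spec ⟨_, hJ⟩ : IsJostSolution V k (jostSolution V k)).eqOn
    hV.intervalIntegrable hk hJ self_mem_Ici
  rwa [jostSol_zero_right] at h0

theorem norm_jostSol_le (hV : MarchenkoClass V) (hk : 0 ≤ k.im) (hx : 0 ≤ x) :
    ‖jostSol V k x‖ ≤ Real.exp (tail (fun t => t * ‖V t‖) 0) * Real.exp (-(k.im * x)) := by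
  rw [jostSol, norm_mul, Complex.norm_exp, mul_comm]
  gcongr
  · exact (hV.kernelBound hk).norm_jostFactor_le_const hx
  · simp

end MarchenkoClass

theorem mapClusterPt_zero_of_memLp {E : Type*} [NormedAddCommGroup E] {u : ℝ → E} {p : ℝ≥0∞}
    (hp0 : p ≠ 0) (hp : p ≠ ∞) (hu : MemLp u p (volume.restrict (Ioi 0))) (h : ℝ) :
    MapClusterPt (0 : E × E) atTop fun x => (u x, u (x + h)) := by
  refine Metric.nhds_basis_ball.mapClusterPt_iff_frequently.2 fun ε hε hev => ?_
  obtain ⟨X, hX⟩ := eventually_atTop.1 hev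
  set S : Set ℝ := {x | ε ≤ ‖u x‖} ∩ Ioi 0
  have hS : volume S < ∞ := by
    have hlt := hu.meas_ge_lt_top hp0 hp (ε := ⟨ε, hε.le⟩)
      (fun h0 => hε.ne' (congrArg NNReal.toReal h0))
    rwa [Measure.restrict_apply' measurableSet_Ioi] at hlt
  have hsub : Ioi (max X |h|) ⊆ S ∪ (fun x => x + h) ⁻¹' S := by
    intro x hx
    obtain ⟨hXx, hhx⟩ := max_lt_iff.1 (mem_Ioi.1 hx)
    have hx0 : 0 < x := (abs_nonneg h).trans_lt hhx
    have hxh : 0 < x + h := by linarith [neg_abs_le h]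
    rcases lt_or_ge ‖u x‖ ε with hux | hux
    · refine Or.inr ⟨show ε ≤ ‖u (x + h)‖ from not_lt.1 fun huxh => hX x hXx.le ?_, hxh⟩
      exact mem_ball_zero_iff.2 (max_lt hux huxh)
    · exact Or.inl ⟨hux, hx0⟩
  have hlt : volume (Ioi (max X |h|)) < ∞ := by
    refine (measure_mono hsub).trans_lt ((measure_union_le _ _).trans_lt ?_)
    rw [measure_preimage_add_right]
    exact ENNReal.add_lt_top.2 ⟨hS, hS⟩
  exact hlt.ne Real.volume_Ioi

section KerPow

variable {E : Type*} [AddCommGroup E] [Module ℂ E] {T : E →ₗ.[ℂ] E} {z : ℂ} {n : ℕ} {u : E}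

theorem mem_kerPow_succ :
    u ∈ kerPow T z (n + 1) ↔ ∃ f, (u, f) ∈ T.graph ∧ f - z • u ∈ kerPow T z n := by
  rw [kerPow, Submodule.mem_map]
  constructor
  · rintro ⟨v, hv, rfl⟩
    exact ⟨T v, T.mem_graph v, hv⟩
  · rintro ⟨f, hf, hv⟩
    obtain ⟨v, rfl, rfl⟩ := T.mem_graph_iff.1 hf
    exact ⟨v, hv, rfl⟩

theorem mem_kerPow_one : u ∈ kerPow T z 1 ↔ (u, z • u) ∈ T.graph := by
  rw [mem_kerPow_succ]
  simp only [kerPow, Submodule.mem_bot, sub_eq_zero, exists_eq_right]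

theorem monotone_kerPow (T : E →ₗ.[ℂ] E) (z : ℂ) : Monotone (kerPow T z) := by
  refine monotone_nat_of_le_succ fun n => ?_
  induction n with
  | zero => exact bot_le
  | succ n ih => exact Submodule.map_mono (Submodule.comap_mono ih)

theorem rank_kerPow_succ_le (T : E →ₗ.[ℂ] E) (z : ℂ) (n : ℕ) :
    Module.rank ℂ (kerPow T z (n + 1)) ≤
      Module.rank ℂ (kerPow T z n) + Module.rank ℂ (kerPow T z 1) := by
  let g : (kerPow T z n).comap (T.toFun - z • T.domain.subtype) →ₗ[ℂ] kerPow T z n :=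
    (T.toFun - z • T.domain.subtype).restrict fun x hx => hx
  have hker (w : LinearMap.ker g) : (w.1.1 : E) ∈ kerPow T z 1 := by
    have hw : T w.1.1 = z • (w.1.1 : E) := sub_eq_zero.1 (congrArg Subtype.val w.2)
    exact mem_kerPow_one.2 (hw ▸ T.mem_graph w.1.1)
  let i : LinearMap.ker g →ₗ[ℂ] kerPow T z 1 :=
    (T.domain.subtype ∘ₗ Submodule.subtype _ ∘ₗ Submodule.subtype _).codRestrict _ hker
  have hi : Function.Injective i := fun v w hvw => by
    have hval : (v.1.1 : E) = w.1.1 := (congrArg Subtype.val hvw :)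
    exact Subtype.ext (Subtype.ext (Subtype.ext hval))
  rw [kerPow]
  refine (rank_map_le _ _).trans ?_
  rw [← g.rank_range_add_rank_ker]
  exact add_le_add (Submodule.rank_le _) (LinearMap.rank_le_of_injective i hi)

theorem rank_kerPow_le (h : Module.rank ℂ (kerPow T z 1) ≤ 1) (n : ℕ) :
    Module.rank ℂ (kerPow T z n) ≤ n := by
  induction n with
  | zero =>
    rw [kerPow, Nat.cast_zero]
    exact (rank_bot ℂ E).le
  | succ n ih =>
    rw [Nat.cast_add, Nat.cast_one]
    exact (rank_kerPow_succ_le T z n).trans (add_le_add ih h)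

theorem algMultiplicity_le_of_kerPow_succ_le {N : ℕ} (h : Module.rank ℂ (kerPow T z 1) ≤ 1)
    (hN : ∀ n, N ≤ n → kerPow T z (n + 1) ≤ kerPow T z n) : algMultiplicity T z ≤ N := by
  have hsup : ⨆ n, kerPow T z n ≤ kerPow T z N := by
    refine iSup_le fun n => ?_
    rcases le_total n N with hn | hn
    · exact monotone_kerPow T z hn
    · induction n, hn using Nat.le_induction with
      | base => exact le_rfl
      | succ n hn ih => exact (hN n hn).trans ih
  rw [algMultiplicity, ← Cardinal.toENat_nat]
  exact OrderHomClass.mono Cardinal.toENat ((Submodule.rank_mono hsup).trans (rank_kerPow_le h N))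

theorem algMultiplicity_eq_zero (h : kerPow T z 1 = ⊥) : algMultiplicity T z = 0 := by
  have hbot (n : ℕ) : kerPow T z n = ⊥ := by
    induction n with
    | zero => rfl
    | succ n ih =>
      rw [kerPow, ih]
      exact h
  simp [algMultiplicity, hbot]

end KerPow

theorem mem_graph_iff {V : ℝ → ℂ} {u f : H} : (u, f) ∈ graph V ↔
    ∃ y p : ℝ → ℂ, u =ᵐ[volume.restrict (Ioi (0 : ℝ))] y ∧ y 0 = 0 ∧ SolvesWith V f y p := by
  change (∃ y : ℝ → ℂ, u =ᵐ[volume.restrict (Ioi (0 : ℝ))] y ∧ y 0 = 0 ∧ Solves V f y) ↔ _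
  simp only [solves_iff_exists_solvesWith, exists_and_left]

theorem exists_solvesWith_of_mem_kerPow_one {V : ℝ → ℂ} {z : ℂ} {u : H}
    (hu : u ∈ kerPow (operator V) z 1) : ∃ y p : ℝ → ℂ, u =ᵐ[volume.restrict (Ioi (0 : ℝ))] y ∧
      y 0 = 0 ∧ SolvesWith V (fun x => z * y x) y p := by
  rw [mem_kerPow_one, operator_graph, mem_graph_iff] at hu
  obtain ⟨y, p, huy, hy0, hy⟩ := hu
  refine ⟨y, p, huy, hy0, hy.congr_ae ?_⟩
  filter_upwards [Lp.coeFn_smul z u, huy] with x hx hxy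
  rw [hx, Pi.smul_apply, smul_eq_mul, hxy]

theorem eq_smul_of_ae_eq {u v : H} {y w : ℝ → ℂ} {c : ℂ}
    (hu : u =ᵐ[volume.restrict (Ioi (0 : ℝ))] y) (hv : v =ᵐ[volume.restrict (Ioi (0 : ℝ))] w)
    (h : ∀ x, 0 ≤ x → w x = c * y x) : v = c • u := by
  refine Lp.ext ?_
  filter_upwards [Lp.coeFn_smul c u, hu, hv, ae_restrict_mem measurableSet_Ioi]
    with x hx hux hvx hx0
  rw [hx, hvx, h x (le_of_lt hx0), Pi.smul_apply, smul_eq_mul, hux]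

theorem eq_zero_of_solvesWith {V : ℝ → ℂ} (hV : ∀ x, 0 ≤ x → IntervalIntegrable V volume 0 x)
    {z : ℂ} {u : H} {y p : ℝ → ℂ} (hu : u =ᵐ[volume.restrict (Ioi (0 : ℝ))] y)
    (hy : SolvesWith V (fun x => z * y x) y p) (hy0 : y 0 = 0) (hp0 : p 0 = 0) : u = 0 := by
  simpa using eq_smul_of_ae_eq (c := 0) hu hu fun x hx => by
    rw [hy.eq_zero hV hy0 hp0 hx, mul_zero]

theorem rank_kerPow_one_le_one {V : ℝ → ℂ} (hV : ∀ x, 0 ≤ x → IntervalIntegrable V volume 0 x)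
    (z : ℂ) : Module.rank ℂ (kerPow (operator V) z 1) ≤ 1 := by
  rw [rank_submodule_le_one_iff]
  rcases eq_or_ne (kerPow (operator V) z 1) ⊥ with hbot | hbot
  · exact ⟨0, zero_mem _, hbot ▸ bot_le⟩
  obtain ⟨u, hu, hu0⟩ := Submodule.exists_mem_ne_zero_of_ne_bot hbot
  obtain ⟨y, p, huy, hy0, hy⟩ := exists_solvesWith_of_mem_kerPow_one hu
  have hp0 : p 0 ≠ 0 := fun hp => hu0 (eq_zero_of_solvesWith hV huy hy hy0 hp)
  refine ⟨u, hu, fun v hv => Submodule.mem_span_singleton.2 ?_⟩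
  obtain ⟨w, q, hvw, hw0, hw⟩ := exists_solvesWith_of_mem_kerPow_one hv
  refine ⟨q 0 / p 0, (eq_smul_of_ae_eq huy hvw fun x hx => hy.eq_const_mul hV hw ?_ ?_ hx).symm⟩
  · rw [hy0, hw0, mul_zero]
  · rw [div_mul_cancel₀ _ hp0]

theorem MarchenkoClass.kerPow_one_eq_bot {V : ℝ → ℂ} (hV : MarchenkoClass V) {k : ℂ}
    (hk : k.im = 0) : kerPow (operator V) (k ^ 2) 1 = ⊥ := by
  refine (Submodule.eq_bot_iff _).2 fun u hu => ?_
  obtain ⟨y, p, huy, -, hy⟩ := exists_solvesWith_of_mem_kerPow_one hu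
  have hcluster := mapClusterPt_zero_of_memLp two_ne_zero ENNReal.ofNat_ne_top
    ((memLp_congr_ae huy).1 (Lp.memLp u))
  obtain ⟨c, hc⟩ := (hV.solvesWith_jostSol hk.ge).exists_eq_const_mul hV.intervalIntegrable hk.ge
    (hV.isJostSolution_jostSol hk.ge).2 hy fun h _ => hcluster h
  have hlim : Tendsto (fun x => ‖y x‖) atTop (𝓝 ‖c‖) := by
    have hJ := ((hV.isJostSolution_jostSol hk.ge).2.const_mul c).norm
    rw [mul_one] at hJ
    refine hJ.congr' ?_
    filter_upwards [eventually_ge_atTop 0] with x hx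
    rw [← mul_assoc, ← hc x hx, norm_mul, Complex.norm_exp]
    simp [hk]
  have hc0 : c = 0 := by
    have hnorm : MapClusterPt 0 atTop fun x => ‖y x‖ := by
      simpa using! (hcluster 0).continuousAt_comp
        (f := fun w : ℂ × ℂ => ‖w.1‖) (Continuous.continuousAt (by fun_prop))
    exact norm_eq_zero.1 (eq_of_nhds_neBot (ClusterPt.mono hnorm hlim)).symm
  simpa using eq_smul_of_ae_eq (c := 0) huy huy fun x hx => by rw [hc x hx, hc0]; simp

theorem memLp_two_exp_neg {δ : ℝ} (hδ : 0 < δ) :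
    MemLp (fun x : ℝ => Real.exp (-(δ * x))) 2 (volume.restrict (Ioi 0)) := by
  rw [memLp_two_iff_integrable_sq (Continuous.aestronglyMeasurable (by fun_prop))]
  refine (exp_neg_integrableOn_Ioi 0 (mul_pos two_pos hδ)).congr (.of_forall fun x => ?_)
  simp only [← Real.exp_nat_mul]
  congr 1
  push_cast
  ring

/-- The bilinear pairing `∫₀^∞ e(x, κ) u(x) dx` of a function with the Jost solution. -/
def jostPairing (V : ℝ → ℂ) (u : ℝ → ℂ) (κ : ℂ) : ℂ := ∫ x in Ioi (0 : ℝ), jostSol V κ x * u x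

theorem jostPairing_congr_ae {V u v : ℝ → ℂ} (h : u =ᵐ[volume.restrict (Ioi (0 : ℝ))] v) (κ : ℂ) :
    jostPairing V u κ = jostPairing V v κ :=
  integral_congr_ae (h.mono fun x hx => by simp only [hx])

namespace MarchenkoClass

variable {V y f r : ℝ → ℂ} {κ z : ℂ} {u v : H}

theorem memLp_jostSol (hV : MarchenkoClass V) (hκ : 0 < κ.im) :
    MemLp (jostSol V κ) 2 (volume.restrict (Ioi 0)) := by
  refine ((memLp_two_exp_neg hκ).const_mul (Real.exp (tail (fun t => t * ‖V t‖) 0))).mono' ?_ ?_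
  · exact ((hV.solvesWith_jostSol hκ.le).continuousOn.mono
      Ioi_subset_Ici_self).aestronglyMeasurable measurableSet_Ioi
  · filter_upwards [ae_restrict_mem measurableSet_Ioi] with x hx
    exact hV.norm_jostSol_le hκ.le (le_of_lt hx)

theorem integrableOn_jostSol_mul (hV : MarchenkoClass V) (hκ : 0 < κ.im)
    (hf : MemLp f 2 (volume.restrict (Ioi 0))) :
    IntegrableOn (fun x => jostSol V κ x * f x) (Ioi 0) :=
  (hV.memLp_jostSol hκ).integrable_mul hf

theorem jostPairing_sub_smul (hV : MarchenkoClass V) (hκ : 0 < κ.im) :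
    jostPairing V (v - z • u : H) κ = jostPairing V v κ - z * jostPairing V u κ := by
  have hu := hV.integrableOn_jostSol_mul hκ (Lp.memLp u)
  have hv := hV.integrableOn_jostSol_mul hκ (Lp.memLp v)
  rw [jostPairing, jostPairing, jostPairing, ← integral_const_mul,
    ← integral_sub hv (hu.const_mul z)]
  refine integral_congr_ae ?_
  filter_upwards [Lp.coeFn_sub v (z • u), Lp.coeFn_smul z u] with x hsub hsmul
  rw [hsub, Pi.sub_apply, hsmul, Pi.smul_apply, smul_eq_mul]
  ring

theorem norm_jostPairing_le (hV : MarchenkoClass V) {δ : ℝ} (hδ : 0 < δ) (hκ : δ ≤ κ.im)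
    (hf : MemLp f 2 (volume.restrict (Ioi 0))) :
    ‖jostPairing V f κ‖ ≤ ∫ x in Ioi (0 : ℝ),
      Real.exp (tail (fun t => t * ‖V t‖) 0) * (Real.exp (-(δ * x)) * ‖f x‖) := by
  refine norm_integral_le_of_norm_le
    (((memLp_two_exp_neg hδ).integrable_mul hf.norm).const_mul _) ?_
  filter_upwards [ae_restrict_mem measurableSet_Ioi] with x hx
  have hx0 : 0 ≤ x := le_of_lt hx
  rw [norm_mul, ← mul_assoc]
  refine mul_le_mul_of_nonneg_right
    ((hV.norm_jostSol_le (hδ.le.trans hκ) hx0).trans ?_) (norm_nonneg _)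
  gcongr

theorem jostPairing_eq_add_wronskian (hV : MarchenkoClass V) (hκ : 0 < κ.im)
    (hy : MemLp y 2 (volume.restrict (Ioi 0))) (hf : MemLp f 2 (volume.restrict (Ioi 0)))
    (h : SolvesWith V f y r) :
    jostPairing V f κ = κ ^ 2 * jostPairing V y κ +
      (jostSol V κ 0 * r 0 - jostSolDeriv V κ 0 * y 0) := by
  have hJ := hV.solvesWith_jostSol hκ.le
  have hW := hJ.isPrimitive_wronskian h
  have hy_int := (hV.integrableOn_jostSol_mul hκ hy).const_mul (κ ^ 2)
  have hf_int := hV.integrableOn_jostSol_mul hκ hf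
  have hlim : Tendsto (fun x => jostSol V κ x * r x - jostSolDeriv V κ x * y x) atTop
      (𝓝 (jostSol V κ 0 * r 0 - jostSolDeriv V κ 0 * y 0 +
        (κ ^ 2 * jostPairing V y κ - jostPairing V f κ))) := by
    rw [jostPairing, jostPairing, ← integral_const_mul, ← integral_sub hy_int hf_int]
    refine ((intervalIntegral_tendsto_integral_Ioi 0 (hy_int.sub hf_int)
      tendsto_id).const_add _).congr' ?_
    filter_upwards [eventually_ge_atTop 0] with x hx
    simp only [hW.eq_add_integral x hx, Pi.sub_apply, id, mul_assoc]
  have hpos : ∀ᶠ x : ℝ in atTop, 0 < x := eventually_gt_atTop 0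
  have hzero := eq_zero_of_tendsto_wronskian hκ.le (hpos.mono fun x hx => hJ.hasDerivAt hx)
    (hV.isJostSolution_jostSol hκ.le).2 (hpos.mono fun x hx => h.hasDerivAt hx) hlim
    fun h _ => mapClusterPt_zero_of_memLp two_ne_zero ENNReal.ofNat_ne_top hy h
  linear_combination -hzero

theorem sub_mul_jostPairing (hV : MarchenkoClass V) (hκ : 0 < κ.im)
    (hu : u =ᵐ[volume.restrict (Ioi (0 : ℝ))] y) (hy0 : y 0 = 0) (h : SolvesWith V v y r) :
    (κ ^ 2 - z) * jostPairing V u κ =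
      jostPairing V (v - z • u : H) κ - jostFactor V κ 0 * r 0 := by
  have hgreen := hV.jostPairing_eq_add_wronskian hκ
    ((memLp_congr_ae hu).1 (Lp.memLp u)) (Lp.memLp v) h
  rw [hy0, jostSol_zero_right, ← jostPairing_congr_ae hu] at hgreen
  rw [hV.jostPairing_sub_smul hκ, hgreen]
  ring

theorem exists_polynomial_of_mem_kerPow (hV : MarchenkoClass V) (z : ℂ) (n : ℕ) :
    ∀ u ∈ kerPow (operator V) z (n + 1), ∃ P : Polynomial ℂ,
      (∀ κ : ℂ, 0 < κ.im → (κ ^ 2 - z) ^ (n + 1) * jostPairing V u κ =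
        -(jostFactor V κ 0 * P.eval (κ ^ 2 - z))) ∧
      (P.eval 0 = 0 → u ∈ kerPow (operator V) z n) := by
  induction n with
  | zero =>
    intro u hu
    obtain ⟨y, r, huy, hy0, hy⟩ := exists_solvesWith_of_mem_kerPow_one hu
    refine ⟨Polynomial.C (r 0), fun κ hκ => ?_, fun hr => ?_⟩
    · have hyL : MemLp y 2 (volume.restrict (Ioi 0)) := (memLp_congr_ae huy).1 (Lp.memLp u)
      have hgreen := hV.jostPairing_eq_add_wronskian hκ hyL (hyL.const_mul z) hy
      have hsmul : jostPairing V (fun x => z * y x) κ = z * jostPairing V y κ := by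
        simp only [jostPairing, mul_left_comm, integral_const_mul]
      rw [hsmul, hy0, jostSol_zero_right] at hgreen
      rw [jostPairing_congr_ae huy, Polynomial.eval_C]
      linear_combination -hgreen
    · rw [Polynomial.eval_C] at hr
      exact eq_zero_of_solvesWith hV.intervalIntegrable huy hy hy0 hr ▸ zero_mem _
  | succ n ih =>
    intro u hu
    obtain ⟨f, hf, hfu⟩ := mem_kerPow_succ.1 hu
    obtain ⟨P, hP, hP0⟩ := ih _ hfu
    obtain ⟨y, r, huy, hy0, hy⟩ := mem_graph_iff.1 (operator_graph V ▸ hf)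
    refine ⟨P + Polynomial.C (r 0) * Polynomial.X ^ (n + 1), fun κ hκ => ?_, fun h0 => ?_⟩
    · simp only [Polynomial.eval_add, Polynomial.eval_mul, Polynomial.eval_C, Polynomial.eval_pow,
        Polynomial.eval_X]
      linear_combination (κ ^ 2 - z) ^ (n + 1) * hV.sub_mul_jostPairing (z := z) hκ huy hy0 hy +
        hP κ hκ
    · exact mem_kerPow_succ.2 ⟨f, hf, hP0 (by simpa using h0)⟩

theorem isBigO_jostFactor_of_mem_kerPow (hV : MarchenkoClass V) {k : ℂ} (hk : 0 < k.im) {n : ℕ}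
    (hu : u ∈ kerPow (operator V) (k ^ 2) (n + 1)) (hu' : u ∉ kerPow (operator V) (k ^ 2) n) :
    (fun κ => jostFactor V κ 0) =O[𝓝 k] fun κ => (κ - k) ^ (n + 1) := by
  obtain ⟨P, hP, hP0⟩ := hV.exists_polynomial_of_mem_kerPow (k ^ 2) n u hu
  have hPlim : Tendsto (fun κ : ℂ => P.eval (κ ^ 2 - k ^ 2)) (𝓝 k) (𝓝 (P.eval 0)) := by
    have hcont : Continuous fun κ : ℂ => P.eval (κ ^ 2 - k ^ 2) := P.continuous.comp (by fun_prop)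
    simpa using hcont.tendsto k
  have hne : P.eval 0 ≠ 0 := fun h => hu' (hP0 h)
  have him {δ : ℝ} (hδ : δ < k.im) : ∀ᶠ κ in 𝓝 k, δ < κ.im :=
    Complex.continuous_im.continuousAt.eventually (lt_mem_nhds hδ)
  have hpair : (fun κ => jostPairing V u κ) =O[𝓝 k] fun _ => (1 : ℂ) :=
    (Asymptotics.isBigO_one_iff ℂ).2 (isBoundedUnder_of_eventually_le
      ((him (half_lt_self hk)).mono fun κ hκ =>
        hV.norm_jostPairing_le (half_pos hk) hκ.le (Lp.memLp u)))
  have hadd : (fun κ : ℂ => (κ + k) ^ (n + 1)) =O[𝓝 k] fun _ => (1 : ℂ) :=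
    ((by fun_prop : Continuous fun κ : ℂ => (κ + k) ^ (n + 1)).tendsto k).isBigO_one ℂ
  have hprod := (((Asymptotics.isBigO_refl (fun κ : ℂ => (κ - k) ^ (n + 1)) (𝓝 k)).mul hadd).mul
    hpair).mul ((hPlim.inv₀ hne).isBigO_one ℂ)
  simp only [mul_one] at hprod
  refine hprod.neg_left.congr' ?_ .rfl
  filter_upwards [him hk, hPlim.eventually_ne hne] with κ hκ hPκ
  have hsq : (κ - k) * (κ + k) = κ ^ 2 - k ^ 2 := by ring
  rw [← mul_pow, hsq, hP κ hκ, neg_mul, neg_neg, mul_inv_cancel_right₀ hPκ]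

end MarchenkoClass

theorem natCast_le_analyticOrderAt_of_isBigO {𝕜 E : Type*} [NontriviallyNormedField 𝕜]
    [NormedAddCommGroup E] [NormedSpace 𝕜 E] {F : 𝕜 → E} {s : Set 𝕜} {k : 𝕜} {n : ℕ}
    (hk : AccPt k (𝓟 s)) (hF : AnalyticAt 𝕜 F k) (h : F =O[𝓝[s] k] fun w => (w - k) ^ n) :
    n ≤ analyticOrderAt F k := by
  by_contra! hlt
  obtain ⟨m, hm⟩ := ENat.ne_top_iff_exists.1 hlt.ne_top
  rw [← hm, Nat.cast_lt] at hlt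
  obtain ⟨g, hg, hg0, hFg⟩ := hF.analyticOrderAt_eq_natCast.1 hm.symm
  have hle : 𝓝[≠] k ⊓ 𝓟 s ≤ 𝓝[s] k := inf_le_inf_right _ nhdsWithin_le_nhds
  have hle' : 𝓝[≠] k ⊓ 𝓟 s ≤ 𝓝 k := hle.trans nhdsWithin_le_nhds
  have hFm : (fun w => (w - k) ^ m) =O[𝓝 k] F := by
    have hg1 : (fun _ => (1 : 𝕜)) =O[𝓝 k] g :=
      (Asymptotics.isBigO_const_left_iff_pos_le_norm one_ne_zero).2
        ⟨‖g k‖ / 2, half_pos (norm_pos_iff.2 hg0), (hg.continuousAt.norm.eventually_const_lt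
          (half_lt_self (norm_pos_iff.2 hg0))).mono fun _ => le_of_lt⟩
    exact ((Asymptotics.isBigO_refl (fun w => (w - k) ^ m) (𝓝 k)).smul hg1).congr'
      (.of_forall fun w => by simp) (EventuallyEq.symm hFg)
  have hself : (fun w => (w - k) ^ m) =o[𝓝[≠] k ⊓ 𝓟 s] fun w => (w - k) ^ m :=
    ((hFm.mono hle').trans (h.mono hle)).trans_isLittleO
      ((by simpa only [← norm_pow, Asymptotics.isLittleO_norm_norm] using
        Asymptotics.isLittleO_pow_sub_pow_sub k hlt :
          (fun w => (w - k) ^ n) =o[𝓝 k] fun w => (w - k) ^ m).mono hle')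
  have : (𝓝[≠] k ⊓ 𝓟 s).NeBot := hk
  refine Asymptotics.isLittleO_irrefl ?_ hself
  refine Eventually.frequently ?_
  filter_upwards [mem_inf_of_left self_mem_nhdsWithin] with w hw
  exact pow_ne_zero m (sub_ne_zero.2 hw)

theorem accPt_closedUpper {k : ℂ} (hk : 0 ≤ k.im) : AccPt k (𝓟 closedUpper) := by
  have hconv : Convex ℝ closedUpper := convex_halfSpace_im_ge 0
  exact hconv.isPreconnected.preperfect_of_nontrivial
    ⟨0, by simp [closedUpper], Complex.I, by simp [closedUpper], Complex.I_ne_zero.symm⟩ k hk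

section Jensen

variable {f : ℂ → ℂ} {U : Set ℂ} {c z : ℂ} {r ρ M : ℝ}

theorem analyticOrderAt_eq_ofReal_divisor (hf : AnalyticOnNhd ℂ f U) (hU : IsPreconnected U)
    (hcU : c ∈ U) (hc : f c ≠ 0) (hz : z ∈ U) :
    (analyticOrderAt f z : ℝ≥0∞) = ENNReal.ofReal (MeromorphicOn.divisor f U z) := by
  have hne : analyticOrderAt f z ≠ ⊤ :=
    hf.analyticOrderAt_ne_top_of_isPreconnected hU hcU hz
      (by simp [(hf c hcU).analyticOrderAt_eq_zero.2 hc])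
  obtain ⟨n, hn⟩ := ENat.ne_top_iff_exists.1 hne
  rw [MeromorphicOn.AnalyticOnNhd.divisor_apply hf hz, ← hn]
  simp

theorem tsum_analyticOrderAt_le {S : Set ℂ} (hr : 0 < r) (hrρ : r < ρ) (hM : 1 ≤ M)
    (hf : AnalyticOnNhd ℂ f (Metric.closedBall c ρ)) (hc : f c ≠ 0)
    (hb : ∀ z ∈ Metric.sphere c ρ, ‖f z‖ ≤ M)
    (hS : ∀ z ∈ S, f z = 0 → z ∈ Metric.closedBall c r) :
    ∑' z : S, (analyticOrderAt f z : ℝ≥0∞) ≤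
      ENNReal.ofReal (Real.log (M / ‖f c‖) / Real.log (ρ / r)) := by
  have hJensen := AnalyticOnNhd.sum_divisor_le (c := c) (r := r) (R := ρ) (M := M) (f := f)
  rw [abs_of_pos hr, abs_of_pos (hr.trans hrρ)] at hJensen
  have hfr := hf.mono (Metric.closedBall_subset_closedBall hrρ.le)
  set D := MeromorphicOn.divisor f (Metric.closedBall c r)
  have hD (z : ℂ) : (0 : ℝ) ≤ D z := Int.cast_nonneg
    (MeromorphicOn.AnalyticOnNhd.divisor_nonneg hfr z)
  have hfin : D.support.Finite := D.finiteSupport (isCompact_closedBall c r)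
  have hfinR : (Function.support fun z => (D z : ℝ)).Finite := by
    simpa [Function.support] using hfin
  have hle (z : S) : (analyticOrderAt f z : ℝ≥0∞) ≤ ENNReal.ofReal (D z) := by
    rcases eq_or_ne (analyticOrderAt f z) 0 with h0 | h0
    · simp [h0]
    · exact (analyticOrderAt_eq_ofReal_divisor hfr (convex_closedBall c r).isPreconnected
        (Metric.mem_closedBall_self hr.le) hc
        (hS z z.2 (analyticOrderAt_ne_zero.1 h0).2)).le
  calc ∑' z : S, (analyticOrderAt f z : ℝ≥0∞)
      ≤ ∑' z : S, ENNReal.ofReal (D z) := ENNReal.tsum_le_tsum hle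
    _ ≤ ∑' z, ENNReal.ofReal (D z) :=
        ENNReal.tsum_comp_le_tsum_of_injective Subtype.val_injective _
    _ = ENNReal.ofReal (∑' z, (D z : ℝ)) :=
        (ENNReal.ofReal_tsum_of_nonneg hD (summable_of_hasFiniteSupport hfinR)).symm
    _ = ENNReal.ofReal ((∑ᶠ z, D z : ℤ) : ℝ) := by
        rw [tsum_eq_finsum hfinR]
        exact congrArg _ (map_finsum (Int.castRingHom ℝ) hfin).symm
    _ ≤ _ := ENNReal.ofReal_le_ofReal (hJensen hr hrρ hM hf hc hb)

end Jensen

theorem analyticOnNhd_jostFactor {V : ℝ → ℂ} {q : ℝ → ℝ} {U : Set ℂ} {x : ℝ} (hU : IsOpen U)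
    (h : ∀ k ∈ U, KernelBound V k q) (hx : 0 ≤ x) :
    AnalyticOnNhd ℂ (fun k => jostFactor V k x) U :=
  (differentiableOn_jostFactor hU h hx).analyticOnNhd hU

theorem MarchenkoClass.algMultiplicity_le {V : ℝ → ℂ} (hV : MarchenkoClass V) {k : ℂ}
    (hk : 0 < k.im) :
    algMultiplicity (operator V) (k ^ 2) ≤ analyticOrderAt (fun κ => jostFactor V κ 0) k := by
  rcases eq_or_ne (analyticOrderAt (fun κ => jostFactor V κ 0) k) ⊤ with htop | htop
  · exact htop ▸ le_top
  obtain ⟨N, hN⟩ := ENat.ne_top_iff_exists.1 htop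
  have hanalytic : AnalyticAt ℂ (fun κ => jostFactor V κ 0) k :=
    analyticOnNhd_jostFactor (isOpen_lt continuous_const Complex.continuous_im)
      (fun κ hκ => hV.kernelBound (le_of_lt hκ)) le_rfl k hk
  rw [← hN]
  refine algMultiplicity_le_of_kerPow_succ_le (rank_kerPow_one_le_one hV.intervalIntegrable _)
    fun n hn u hu => ?_
  by_contra hu'
  have hle := natCast_le_analyticOrderAt_of_isBigO (accPt_closedUpper hk.le) hanalytic
    ((hV.isBigO_jostFactor_of_mem_kerPow hk hu hu').mono nhdsWithin_le_nhds)
  rw [← hN, Nat.cast_le] at hle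
  omega

section RadiusBound

variable {V : ℝ → ℂ} {α c : ℝ} {k : ℂ}

theorem integral_two_mul_rpow_mul_norm_nonneg (V : ℝ → ℂ) (α : ℝ) :
    0 ≤ ∫ x in Ioi (0 : ℝ), (2 * x) ^ α * ‖V x‖ :=
  setIntegral_nonneg measurableSet_Ioi fun _ hx =>
    mul_nonneg (Real.rpow_nonneg (mul_pos two_pos hx).le _) (norm_nonneg _)

theorem radiusBound_nonneg (V : ℝ → ℂ) (α : ℝ) : 0 ≤ radiusBound V α :=
  Real.rpow_nonneg (mul_nonneg (one_div_pos.2 (Real.log_pos one_lt_two)).le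
    (integral_two_mul_rpow_mul_norm_nonneg V α)) _

theorem two_rpow_radiusBound_div_rpow (hα : α < 1) (hc : 0 ≤ c) :
    (2 : ℝ) ^ (radiusBound V α / c) ^ (1 - α) =
      Real.exp ((∫ x in Ioi (0 : ℝ), (2 * x) ^ α * ‖V x‖) / c ^ (1 - α)) := by
  have := Real.log_pos one_lt_two
  have hI := integral_two_mul_rpow_mul_norm_nonneg V α
  rw [Real.div_rpow (radiusBound_nonneg V α) hc, radiusBound, ← Real.rpow_mul (by positivity),
    one_div_mul_cancel (sub_pos.2 hα).ne', Real.rpow_one, Real.rpow_def_of_pos two_pos]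
  congr 1
  field

theorem two_sub_two_rpow_mem_Ioc (hα : α < 1) (hc : radiusBound V α < c) :
    2 - (2 : ℝ) ^ (radiusBound V α / c) ^ (1 - α) ∈ Ioc (0 : ℝ) 1 := by
  have hR := radiusBound_nonneg V α
  have hc0 : 0 < c := hR.trans_lt hc
  have hlt : (radiusBound V α / c) ^ (1 - α) < 1 :=
    Real.rpow_lt_one (by positivity) ((div_lt_one hc0).2 hc) (sub_pos.2 hα)
  have hlt_two := Real.rpow_lt_rpow_of_exponent_lt one_lt_two hlt
  have hone_le := Real.one_le_rpow one_le_two (by positivity : 0 ≤ (radiusBound V α / c) ^ (1 - α))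
  rw [Real.rpow_one] at hlt_two
  exact ⟨by linarith, by linarith⟩

theorem rpow_le_one_add {t : ℝ} (ht : 0 ≤ t) (hα : α ∈ Icc (0 : ℝ) 1) : t ^ α ≤ 1 + t :=
  calc t ^ α ≤ (1 + t) ^ α := Real.rpow_le_rpow ht (le_add_of_nonneg_left zero_le_one) hα.1
    _ ≤ (1 + t) ^ (1 : ℝ) := Real.rpow_le_rpow_of_exponent_le (le_add_of_nonneg_right ht) hα.2
    _ = 1 + t := Real.rpow_one _

theorem kernelBound_rpow {b c β : ℝ} (hV : AEStronglyMeasurable V (volume.restrict (Ioi 0)))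
    (hI : IntegrableOn (fun t : ℝ => t ^ β * (1 + Real.exp (b * t)) * ‖V t‖) (Ioi 0))
    (hβ : β ∈ Icc (0 : ℝ) 1) (hb : 0 ≤ b) (hk : -(b / 2) ≤ k.im) (hc : 0 < c) (hkc : c ≤ ‖k‖) :
    KernelBound V k fun t =>
      1 / (2 * c) ^ (1 - β) * (t ^ β * (1 + Real.exp (b * t)) * ‖V t‖) where
  integrableOn := hI.const_mul _
  aestronglyMeasurable_potential := hV
  norm_le s t hs hst := by
    rw [← mul_assoc]
    refine mul_le_mul_of_nonneg_right ?_ (norm_nonneg _)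
    refine (norm_volterraKernel_le_rpow hb hk hs hc hkc hβ).trans ?_
    have := hs.trans hst
    gcongr
    exact hβ.1

namespace MarchenkoClass

theorem kernelBound_two_mul_rpow (hV : MarchenkoClass V) (hα : α ∈ Icc (0 : ℝ) 1) (hk0 : k ≠ 0)
    (hk : 0 ≤ k.im) : KernelBound V k fun t => (2 * t) ^ α * ‖V t‖ / ‖k‖ ^ (1 - α) where
  integrableOn := by
    refine (hV.integrableOn_mul_norm (C := 2) (by fun_prop (disch := exact hα.1))
      fun t ht => ?_).div_const _
    rw [Real.norm_of_nonneg (by positivity)]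
    linarith [rpow_le_one_add (mul_pos two_pos ht).le hα]
  aestronglyMeasurable_potential := hV.aestronglyMeasurable
  norm_le s t hs hst := by
    have hkn : 0 < ‖k‖ := norm_pos_iff.2 hk0
    have htwo : (2 : ℝ) ^ α * 2 ^ (1 - α) = 2 := by
      rw [← Real.rpow_add two_pos, add_sub_cancel, Real.rpow_one]
    have hle := norm_volterraKernel_le_rpow le_rfl (by simpa using hk) hs hkn le_rfl hα
    rw [mul_div_right_comm]
    refine mul_le_mul_of_nonneg_right (hle.trans ?_) (norm_nonneg _)
    calc 1 / (2 * ‖k‖) ^ (1 - α) * (s ^ α * (1 + Real.exp (0 * s)))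
        = (2 * s) ^ α / ‖k‖ ^ (1 - α) := by
          rw [Real.mul_rpow two_pos.le hkn.le, Real.mul_rpow two_pos.le hs, zero_mul, Real.exp_zero]
          field_simp
          linear_combination -(s ^ α) * htwo
      _ ≤ (2 * t) ^ α / ‖k‖ ^ (1 - α) := by
          gcongr
          exact hα.1

theorem two_sub_two_rpow_le_norm_jostFactor (hV : MarchenkoClass V) (hα : α ∈ Ico (0 : ℝ) 1)
    (hk0 : k ≠ 0) (hk : 0 ≤ k.im) :
    2 - (2 : ℝ) ^ (radiusBound V α / ‖k‖) ^ (1 - α) ≤ ‖jostFactor V k 0‖ := by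
  have hsub := (hV.kernelBound_two_mul_rpow ⟨hα.1, hα.2.le⟩ hk0 hk).norm_jostFactor_sub_one_le
    le_rfl
  rw [tail, integral_div, ← two_rpow_radiusBound_div_rpow hα.2 (norm_nonneg k)] at hsub
  have htri := norm_sub_norm_le 1 (jostFactor V k 0)
  rw [norm_one, norm_sub_rev] at htri
  linarith

theorem norm_le_radiusBound (hV : MarchenkoClass V) (hα : α ∈ Ico (0 : ℝ) 1) (hk : 0 ≤ k.im)
    (h0 : jostFactor V k 0 = 0) : ‖k‖ ≤ radiusBound V α := by
  by_contra! hlt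
  have hk0 : k ≠ 0 := norm_pos_iff.1 ((radiusBound_nonneg V α).trans_lt hlt)
  have hle := hV.two_sub_two_rpow_le_norm_jostFactor hα hk0 hk
  rw [h0, norm_zero] at hle
  exact hle.not_gt (two_sub_two_rpow_mem_Ioc hα.2 hlt).1

theorem norm_le_zeroRadius (hV : MarchenkoClass V) (hk : 0 ≤ k.im) (h0 : jostFactor V k 0 = 0) :
    ‖k‖ ≤ zeroRadius V := by
  refine le_csInf ⟨radiusBound V 0, radiusBound_nonneg V 0, fun κ hκ hκ0 => ?_⟩
    fun r hr => hr.2 k hk (hV.jost_eq_jostFactor hk ▸ h0)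
  exact hV.norm_le_radiusBound ⟨le_rfl, one_pos⟩ hκ (hV.jost_eq_jostFactor hκ ▸ hκ0)

end MarchenkoClass

end RadiusBound

theorem le_inv_mul_exp {a : ℝ} (ha : 0 < a) (t : ℝ) : t ≤ a⁻¹ * Real.exp (a * t) := by
  rw [le_inv_mul_iff₀ ha]
  linarith [Real.add_one_le_exp (a * t)]

/-- The class of potentials with `∫₀^∞ e^(ax) |V(x)| dx < ∞`, whose Jost functions continue
analytically to the half-plane `Im k > -a/2`. -/
def ExpDecayClass (a : ℝ) (V : ℝ → ℂ) : Prop :=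
  IntegrableOn (fun x => Real.exp (a * x) • V x) (Ioi 0)

namespace ExpDecayClass

variable {V : ℝ → ℂ} {a : ℝ}

theorem aestronglyMeasurable (hV : ExpDecayClass a V) :
    AEStronglyMeasurable V (volume.restrict (Ioi 0)) :=
  aestronglyMeasurable_of_smul (w := fun x => Real.exp (a * x))
    (Continuous.aestronglyMeasurable (by fun_prop)) (.of_forall fun _ => (Real.exp_pos _).ne')
    (Integrable.aestronglyMeasurable hV)

theorem integrableOn_mul_norm (hV : ExpDecayClass a V) {g : ℝ → ℝ} {C : ℝ}
    (hg : AEStronglyMeasurable g (volume.restrict (Ioi 0)))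
    (hC : ∀ t, 0 < t → ‖g t‖ ≤ C * Real.exp (a * t)) :
    IntegrableOn (fun t => g t * ‖V t‖) (Ioi 0) := by
  refine integrable_mul_norm_of_norm_le (C := C) hV hV.aestronglyMeasurable hg ?_
  filter_upwards [ae_restrict_mem measurableSet_Ioi] with t ht
  rw [Real.norm_of_nonneg (Real.exp_pos _).le]
  exact hC t ht

theorem marchenkoClass (hV : ExpDecayClass a V) (ha : 0 < a) : MarchenkoClass V := by
  have hint : IntegrableOn (fun t => (1 + t) * ‖V t‖) (Ioi 0) :=
    hV.integrableOn_mul_norm (C := 1 + a⁻¹) (by fun_prop) fun t ht => by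
      rw [Real.norm_of_nonneg (by positivity), add_mul, one_mul]
      exact add_le_add (Real.one_le_exp (by positivity)) (le_inv_mul_exp ha t)
  have hcont : Continuous fun t : ℝ => 1 + t := by fun_prop
  refine Integrable.mono hint (hcont.aestronglyMeasurable.smul hV.aestronglyMeasurable)
    (.of_forall fun t => ?_)
  simp only [norm_smul, norm_mul, norm_norm, le_refl]

theorem kernelBound (hV : ExpDecayClass a V) {c : ℝ} {k : ℂ} (hc : 0 ≤ c) (hca : c < a)
    (hk : -(c / 2) ≤ k.im) : KernelBound V k fun t => t * Real.exp (c * t) * ‖V t‖ where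
  integrableOn := hV.integrableOn_mul_norm (C := (a - c)⁻¹)
    (Continuous.aestronglyMeasurable (by fun_prop)) fun t ht => by
      rw [Real.norm_of_nonneg (by positivity)]
      calc t * Real.exp (c * t)
          ≤ (a - c)⁻¹ * Real.exp ((a - c) * t) * Real.exp (c * t) := by
            gcongr
            exact le_inv_mul_exp (sub_pos.2 hca) t
        _ = (a - c)⁻¹ * Real.exp (a * t) := by
            rw [mul_assoc, ← Real.exp_add]
            ring_nf
  aestronglyMeasurable_potential := hV.aestronglyMeasurable
  norm_le s t hs hst := by
    have := hs.trans hst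
    refine mul_le_mul_of_nonneg_right ((norm_volterraKernel_le_mul_exp hc hk hs).trans ?_)
      (norm_nonneg _)
    gcongr

theorem analyticOnNhd_jostFactor (hV : ExpDecayClass a V) (ha : 0 < a) :
    AnalyticOnNhd ℂ (fun κ => jostFactor V κ 0) {k | -(a / 2) < k.im} := by
  intro k (hk : -(a / 2) < k.im)
  obtain ⟨c, hc, hca⟩ := exists_between (max_lt ha (by linarith : -(2 * k.im) < a))
  obtain ⟨hc0, hkc⟩ := max_lt_iff.1 hc
  refine HalfLineSchrodinger.analyticOnNhd_jostFactor (U := {κ : ℂ | -(c / 2) < κ.im})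
    (isOpen_lt continuous_const Complex.continuous_im)
    (fun κ hκ => hV.kernelBound hc0.le hca (le_of_lt hκ)) le_rfl k ?_
  exact show -(c / 2) < k.im by linarith

theorem boundaryOrder_jost_le (hV : ExpDecayClass a V) (ha : 0 < a) (k : ℝ) :
    boundaryOrder (jost V) k ≤ analyticOrderAt (fun κ => jostFactor V κ 0) (k : ℂ) := by
  refine iSup₂_le fun n hn => natCast_le_analyticOrderAt_of_isBigO
    (accPt_closedUpper (Complex.ofReal_im k).ge)
    (hV.analyticOnNhd_jostFactor ha _ (by simpa using ha)) (hn.congr' ?_ .rfl)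
  filter_upwards [self_mem_nhdsWithin] with κ hκ
  exact (hV.marchenkoClass ha).jost_eq_jostFactor hκ

end ExpDecayClass

section Count

variable {V : ℝ → ℂ} {a : ℝ}

theorem exists_sq_eq_and_im_nonneg (z : ℂ) : ∃ k : ℂ, k ^ 2 = z ∧ 0 ≤ k.im := by
  obtain ⟨k, hk⟩ := IsAlgClosed.exists_pow_nat_eq z two_pos
  rcases le_total 0 k.im with h | h
  · exact ⟨k, hk, h⟩
  · exact ⟨-k, by rw [neg_sq, hk], by simpa using h⟩

theorem MarchenkoClass.tsum_algMultiplicity_le (hV : MarchenkoClass V) :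
    ∑' z : ℂ, (algMultiplicity (operator V) z : ℝ≥0∞) ≤
      ∑' k : {k : ℂ | 0 < k.im}, (analyticOrderAt (fun κ => jostFactor V κ 0) k : ℝ≥0∞) := by
  have hinj : Function.Injective fun k : {k : ℂ | 0 < k.im} => (k : ℂ) ^ 2 := by
    intro k κ h
    rcases sq_eq_sq_iff_eq_or_eq_neg.1 h with h | h
    · exact Subtype.ext h
    · have hk : 0 < (k : ℂ).im := k.2
      have hκ : 0 < (κ : ℂ).im := κ.2
      rw [h, Complex.neg_im] at hk
      exact absurd hk (by linarith)
  have hsupp : (Function.support fun z => (algMultiplicity (operator V) z : ℝ≥0∞)) ⊆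
      range fun k : {k : ℂ | 0 < k.im} => (k : ℂ) ^ 2 := by
    intro z hz
    obtain ⟨k, rfl, hk⟩ := exists_sq_eq_and_im_nonneg z
    rcases hk.lt_or_eq with hk | hk
    · exact ⟨⟨k, hk⟩, rfl⟩
    · exact absurd (by simp [algMultiplicity_eq_zero (hV.kerPow_one_eq_bot hk.symm)]) hz
  rw [← hinj.tsum_eq hsupp]
  exact ENNReal.tsum_le_tsum fun k => ENat.toENNReal_le.2 (hV.algMultiplicity_le k.2)

theorem ExpDecayClass.tsum_boundaryOrder_le (hV : ExpDecayClass a V) (ha : 0 < a) :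
    ∑' k : ℝ, (boundaryOrder (jost V) k : ℝ≥0∞) ≤
      ∑' k : {k : ℂ | k.im = 0}, (analyticOrderAt (fun κ => jostFactor V κ 0) k : ℝ≥0∞) :=
  (ENNReal.tsum_le_tsum fun k => ENat.toENNReal_le.2 (hV.boundaryOrder_jost_le ha k)).trans
    (ENNReal.tsum_comp_le_tsum_of_injective
      (f := fun k : ℝ => (⟨k, Complex.ofReal_im k⟩ : {k : ℂ | k.im = 0}))
      (fun _ _ h => Complex.ofReal_injective (congrArg Subtype.val h))
      fun k => (analyticOrderAt (fun κ => jostFactor V κ 0) k : ℝ≥0∞))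

theorem ExpDecayClass.totalMultiplicity_le_tsum (hV : ExpDecayClass a V) (ha : 0 < a) :
    totalMultiplicity V ≤
      ∑' k : closedUpper, (analyticOrderAt (fun κ => jostFactor V κ 0) k : ℝ≥0∞) := by
  have hunion : closedUpper = {k : ℂ | 0 < k.im} ∪ {k : ℂ | k.im = 0} := by
    ext k
    exact (le_iff_lt_or_eq (a := 0) (b := k.im)).trans (or_congr_right eq_comm)
  have hdisj : Disjoint {k : ℂ | 0 < k.im} {k : ℂ | k.im = 0} :=
    disjoint_left.2 fun k hk hk0 => hk.ne' hk0
  rw [hunion, ENNReal.summable.tsum_union_disjoint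
    (f := fun k => (analyticOrderAt (fun κ => jostFactor V κ 0) k : ℝ≥0∞)) hdisj ENNReal.summable]
  exact add_le_add (hV.marchenkoClass ha).tsum_algMultiplicity_le (hV.tsum_boundaryOrder_le ha)

end Count

section Geometry

variable {A R ρ : ℝ} {k : ℂ}

theorem sub_le_im_of_mem_closedBall (hk : k ∈ Metric.closedBall (Complex.I * A) ρ) :
    A - ρ ≤ k.im := by
  rw [mem_closedBall_iff_norm'] at hk
  have him := (Complex.im_le_norm _).trans hk
  simp only [Complex.sub_im, Complex.I_mul_im, Complex.ofReal_re] at him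
  linarith

theorem sub_le_norm_of_mem_sphere (hA : 0 ≤ A) (hk : k ∈ Metric.sphere (Complex.I * A) ρ) :
    ρ - A ≤ ‖k‖ := by
  have hle := norm_sub_le k (Complex.I * A)
  rw [mem_sphere_iff_norm.1 hk, norm_mul, Complex.norm_I, one_mul,
    Complex.norm_of_nonneg hA] at hle
  linarith

theorem mem_closedBall_I_mul_of_norm_le (hA : 0 ≤ A) (hk : 0 ≤ k.im) (hR : ‖k‖ ≤ R) :
    k ∈ Metric.closedBall (Complex.I * A) √(A ^ 2 + R ^ 2) := by
  have hsq : ‖k‖ ^ 2 ≤ R ^ 2 := pow_le_pow_left₀ (norm_nonneg k) hR 2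
  rw [mem_closedBall_iff_norm]
  refine Real.le_sqrt_of_sq_le ?_
  rw [Complex.sq_norm, Complex.normSq_apply] at hsq ⊢
  simp only [Complex.sub_re, Complex.sub_im, Complex.I_mul_re, Complex.I_mul_im,
    Complex.ofReal_re, Complex.ofReal_im]
  linarith [mul_nonneg hA hk]

theorem sqrt_sq_add_sq_lt_add_half {a : ℝ} (ha : 0 < a) (hA : 0 ≤ A)
    (h : R ^ 2 / a - a / 4 < A) : √(A ^ 2 + R ^ 2) < A + a / 2 := by
  rw [sub_lt_iff_lt_add, div_lt_iff₀ ha] at h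
  rw [Real.sqrt_lt' (by positivity)]
  linarith

end Geometry

section Bound

variable {V : ℝ → ℂ} {a b α β A : ℝ}

theorem norm_jostFactor_le_of_mem_sphere (hV : AEStronglyMeasurable V (volume.restrict (Ioi 0)))
    (hI : IntegrableOn (fun t : ℝ => t ^ β * (1 + Real.exp (a * t)) * ‖V t‖) (Ioi 0))
    (hβ : β ∈ Icc (0 : ℝ) 1) (hA : 0 ≤ A) (hb : 0 < b) (hba : b ≤ a / 2) {k : ℂ}
    (hk : k ∈ Metric.sphere (Complex.I * A) (A + b)) :
    ‖jostFactor V k 0‖ ≤ Real.exp (1 / (2 * b) ^ (1 - β) *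
      ∫ t in Ioi (0 : ℝ), t ^ β * (1 + Real.exp (a * t)) * ‖V t‖) := by
  have him := sub_le_im_of_mem_closedBall (Metric.sphere_subset_closedBall hk)
  have hnorm := sub_le_norm_of_mem_sphere hA hk
  have hK := kernelBound_rpow (k := k) hV hI hβ (by linarith) (by linarith) hb (by linarith)
  simpa only [tail, integral_const_mul] using hK.norm_jostFactor_le le_rfl

namespace ExpDecayClass

theorem totalMultiplicity_le_of_lt_half (hV : ExpDecayClass a V)
    (hI : IntegrableOn (fun t : ℝ => t ^ β * (1 + Real.exp (a * t)) * ‖V t‖) (Ioi 0))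
    (hα : α ∈ Ico (0 : ℝ) 1) (hβ : β ∈ Icc (0 : ℝ) 1) (hA : radiusBound V α < A) (hb : 0 < b)
    (hba : b < a / 2) (hAb : √(A ^ 2 + zeroRadius V ^ 2) < A + b) :
    totalMultiplicity V ≤ ENNReal.ofReal ((1 / (2 * b) ^ (1 - β) *
        (∫ t in Ioi (0 : ℝ), t ^ β * (1 + Real.exp (a * t)) * ‖V t‖) -
        Real.log (2 - (2 : ℝ) ^ (radiusBound V α / A) ^ (1 - α))) /
      Real.log ((A + b) / √(A ^ 2 + zeroRadius V ^ 2))) := by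
  have ha : 0 < a := by linarith
  have hA0 : 0 < A := (radiusBound_nonneg V α).trans_lt hA
  have hr : 0 < √(A ^ 2 + zeroRadius V ^ 2) := Real.sqrt_pos.2 (by positivity)
  have hlow := (two_sub_two_rpow_mem_Ioc hα.2 hA).1
  have hcenter : 2 - (2 : ℝ) ^ (radiusBound V α / A) ^ (1 - α) ≤
      ‖jostFactor V (Complex.I * A) 0‖ := by
    simpa [abs_of_pos hA0] using (hV.marchenkoClass ha).two_sub_two_rpow_le_norm_jostFactor hα
      (k := Complex.I * A) (by simp [hA0.ne']) (by simpa using hA0.le)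
  have hcenter_pos := hlow.trans_le hcenter
  have hI0 : 0 ≤ ∫ t in Ioi (0 : ℝ), t ^ β * (1 + Real.exp (a * t)) * ‖V t‖ :=
    setIntegral_nonneg measurableSet_Ioi fun t (ht : 0 < t) => by positivity
  have hJensen := tsum_analyticOrderAt_le hr hAb (Real.one_le_exp (by positivity))
    ((hV.analyticOnNhd_jostFactor ha).mono fun k hk => show -(a / 2) < k.im by
      linarith [sub_le_im_of_mem_closedBall hk])
    (norm_pos_iff.1 hcenter_pos)
    (fun k => norm_jostFactor_le_of_mem_sphere hV.aestronglyMeasurable hI hβ hA0.le hb hba.le)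
    (fun k hk h0 => mem_closedBall_I_mul_of_norm_le hA0.le hk
      ((hV.marchenkoClass ha).norm_le_zeroRadius hk h0))
  refine ((hV.totalMultiplicity_le_tsum ha).trans hJensen).trans (ENNReal.ofReal_le_ofReal ?_)
  have hlog := Real.log_pos ((one_lt_div hr).2 hAb)
  rw [Real.log_div (Real.exp_pos _).ne' hcenter_pos.ne', Real.log_exp]
  gcongr

theorem totalMultiplicity_le (hV : ExpDecayClass a V) (ha : 0 < a)
    (hI : IntegrableOn (fun t : ℝ => t ^ β * (1 + Real.exp (a * t)) * ‖V t‖) (Ioi 0))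
    (hα : α ∈ Ico (0 : ℝ) 1) (hβ : β ∈ Icc (0 : ℝ) 1) (hA : radiusBound V α < A)
    (hAa : √(A ^ 2 + zeroRadius V ^ 2) < A + a / 2) :
    totalMultiplicity V ≤ ENNReal.ofReal ((1 / a ^ (1 - β) *
        (∫ t in Ioi (0 : ℝ), t ^ β * (1 + Real.exp (a * t)) * ‖V t‖) -
        Real.log (2 - (2 : ℝ) ^ (radiusBound V α / A) ^ (1 - α))) /
      Real.log ((A + a / 2) / √(A ^ 2 + zeroRadius V ^ 2))) := by
  have hA0 : 0 < A := (radiusBound_nonneg V α).trans_lt hA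
  set I := ∫ t in Ioi (0 : ℝ), t ^ β * (1 + Real.exp (a * t)) * ‖V t‖
  set ℓ := Real.log (2 - (2 : ℝ) ^ (radiusBound V α / A) ^ (1 - α))
  set r := √(A ^ 2 + zeroRadius V ^ 2)
  have hr : 0 < r := Real.sqrt_pos.2 (by positivity)
  have hlog : Real.log ((A + a / 2) / r) ≠ 0 := (Real.log_pos ((one_lt_div hr).2 hAa)).ne'
  have hcont : ContinuousAt (fun b : ℝ => (1 / (2 * b) ^ (1 - β) * I - ℓ) /
      Real.log ((A + b) / r)) (a / 2) := by
    have hpow : ContinuousAt (fun b : ℝ => (2 * b) ^ (1 - β)) (a / 2) :=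
      ContinuousAt.rpow_const (by fun_prop) (.inl (by positivity))
    have hpow0 : (2 * (a / 2)) ^ (1 - β) ≠ 0 := (Real.rpow_pos_of_pos (by positivity) _).ne'
    have hlog_cont : ContinuousAt (fun b : ℝ => Real.log ((A + b) / r)) (a / 2) :=
      ContinuousAt.log (by fun_prop) (by positivity)
    exact (((continuousAt_const.div hpow hpow0).mul_const I).sub_const ℓ).div hlog_cont hlog
  have hlim := (ENNReal.continuous_ofReal.tendsto _).comp
    (hcont.tendsto.mono_left (nhdsWithin_le_nhds (s := Iio (a / 2))))
  rw [mul_div_cancel₀ a two_ne_zero] at hlim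
  refine ge_of_tendsto hlim ?_
  have hlower : max 0 (r - A) < a / 2 := max_lt (by positivity) (by linarith)
  filter_upwards [Ioo_mem_nhdsLT hlower] with b hb
  obtain ⟨hb0, hbA⟩ := max_lt_iff.1 hb.1
  exact hV.totalMultiplicity_le_of_lt_half hI hα hβ hA hb0 hb.2 (by linarith)

end ExpDecayClass

theorem coe_le_inv_mul_sub_of_integrable {Ω : Type*} [MeasurableSpace Ω] {μ : Measure Ω}
    {g : Ω → ℝ} {N : ℝ≥0∞} {c d ℓ : ℝ} (hg : AEStronglyMeasurable g μ) (hg0 : 0 ≤ᵐ[μ] g)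
    (hc : 0 < c) (hd : 0 < d) (hℓ : ℓ ≤ 0)
    (h : Integrable g μ → N ≤ ENNReal.ofReal ((d * ∫ x, g x ∂μ - ℓ) / c)) :
    (N : EReal) ≤ ((c⁻¹ : ℝ) : EReal) *
      ((d : EReal) * ((∫⁻ x, ENNReal.ofReal (g x) ∂μ : ℝ≥0∞) : EReal) - (ℓ : EReal)) := by
  by_cases htop : ∫⁻ x, ENNReal.ofReal (g x) ∂μ = ⊤
  · rw [htop, EReal.coe_ennreal_top, EReal.coe_mul_top_of_pos hd, EReal.top_sub_coe,
      EReal.coe_mul_top_of_pos (inv_pos.2 hc)]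
    exact le_top
  · have hint : Integrable g μ :=
      ⟨hg, (hasFiniteIntegral_iff_ofReal hg0).2 (lt_top_iff_ne_top.2 htop)⟩
    have hint0 : 0 ≤ ∫ x, g x ∂μ := integral_nonneg_of_ae hg0
    have hbound0 : 0 ≤ (d * ∫ x, g x ∂μ - ℓ) / c :=
      div_nonneg (sub_nonneg.2 (hℓ.trans (mul_nonneg hd.le hint0))) hc.le
    have hN := EReal.coe_ennreal_le_coe_ennreal_iff.2 (h hint)
    rw [EReal.coe_ennreal_ofReal, max_eq_left hbound0, div_eq_inv_mul] at hN
    rw [← ofReal_integral_eq_lintegral_ofReal hint hg0, EReal.coe_ennreal_ofReal,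
      max_eq_left hint0]
    exact_mod_cast hN

end Bound

end HalfLineSchrodinger

end

theorem theorem1_general (V : ℝ → ℂ) (a : ℝ) (ha : 0 < a)
    (hV : IntegrableOn (fun x : ℝ => Real.exp (a * x) • V x) (Ioi 0))
    (α β : ℝ) (hα : α ∈ Ico (0 : ℝ) 1) (hβ : β ∈ Icc (0 : ℝ) 1) (A : ℝ)
    (hA : max (HalfLineSchrodinger.radiusBound V α)
      (HalfLineSchrodinger.zeroRadius V ^ 2 / a - a / 4) < A) :
    (HalfLineSchrodinger.totalMultiplicity V : EReal) ≤
      (((Real.log ((A + a / 2) / √(A ^ 2 + HalfLineSchrodinger.zeroRadius V ^ 2)))⁻¹ : ℝ) : EReal) *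
        (((1 / a ^ (1 - β) : ℝ) : EReal) *
            ((∫⁻ x in Ioi (0 : ℝ),
              ENNReal.ofReal (x ^ β * (1 + Real.exp (a * x)) * ‖V x‖) : ℝ≥0∞) : EReal) -
          ((Real.log (2 - (2 : ℝ) ^
            ((HalfLineSchrodinger.radiusBound V α / A) ^ (1 - α))) : ℝ) : EReal)) := by
  have hVa : HalfLineSchrodinger.ExpDecayClass a V := hV
  obtain ⟨hAα, hAR⟩ := max_lt_iff.1 hA
  have hA0 : 0 < A := (HalfLineSchrodinger.radiusBound_nonneg V α).trans_lt hAα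
  have hAa := HalfLineSchrodinger.sqrt_sq_add_sq_lt_add_half ha hA0.le hAR
  have hr : 0 < √(A ^ 2 + HalfLineSchrodinger.zeroRadius V ^ 2) := Real.sqrt_pos.2 (by positivity)
  have hlow := HalfLineSchrodinger.two_sub_two_rpow_mem_Ioc hα.2 hAα
  refine HalfLineSchrodinger.coe_le_inv_mul_sub_of_integrable ?_ ?_
    (Real.log_pos ((one_lt_div hr).2 hAa)) (by positivity) (Real.log_nonpos hlow.1.le hlow.2)
    fun hI => hVa.totalMultiplicity_le ha hI hα hβ hAα hAa
  · exact ((Real.continuous_rpow_const hβ.1).mul (by fun_prop)).aestronglyMeasurable.mul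
      hVa.aestronglyMeasurable.norm
  · filter_upwards [ae_restrict_mem measurableSet_Ioi] with x (hx : 0 < x)
    exact (by positivity : 0 ≤ x ^ β * (1 + Real.exp (a * x)) * ‖V x‖)

/-- The integral in the bound is taken in `[0, ∞]`, since it may diverge when `β > 0`; the
inequality is one of extended reals. -/
theorem theorem1 (V : ℝ → ℂ) (a : ℝ) (ha : 0 < a)
    (hV : IntegrableOn (fun x : ℝ => Real.exp (a * x) • V x) (Ioi 0))
    (α β : ℝ) (hα : α ∈ Ico (0 : ℝ) 1) (hβ : β ∈ Ico (0 : ℝ) 1) (A : ℝ)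
    (hA : max (HalfLineSchrodinger.radiusBound V α)
      (HalfLineSchrodinger.zeroRadius V ^ 2 / a - a / 4) < A) :
    (HalfLineSchrodinger.totalMultiplicity V : EReal) ≤
      (((Real.log ((A + a / 2) / √(A ^ 2 + HalfLineSchrodinger.zeroRadius V ^ 2)))⁻¹ : ℝ) : EReal) *
        (((1 / a ^ (1 - β) : ℝ) : EReal) *
            ((∫⁻ x in Ioi (0 : ℝ),
              ENNReal.ofReal (x ^ β * (1 + Real.exp (a * x)) * ‖V x‖) : ℝ≥0∞) : EReal) -
          ((Real.log (2 - (2 : ℝ) ^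
            ((HalfLineSchrodinger.radiusBound V α / A) ^ (1 - α))) : ℝ) : EReal)) :=
  theorem1_general V a ha hV α β hα (Ico_subset_Icc_self hβ) A hA
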